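/- Let $m\ge 4$ and let $e_1,\dots,e_{2m}$ be the standard basis of $\mathbb{C}^{2m}$, equipped with the symmetric bilinear form $(e_i,e_j)=\delta_{i,2m+1-j}$. Let $\mathfrak{so}_{2m}$ be the Lie algebra of endomorphisms of $\mathbb{C}^{2m}$ that are skew for this form, with the Cartan subalgebra $\mathfrak h$ of diagonal matrices and $\mathfrak n$ the strictly upper triangular matrices in $\mathfrak{so}_{2m}$; let $\psi=\varepsilon_1+\varepsilon_2$ be its highest root, where $\varepsilon_i\in\mathfrak h^*$ takes the $i$-th diagonal entry. Let $V_{2\psi}$ denote the finite-dimensional irreducible representation of $\mathfrak{so}_{2m}$ of highest weight $2\psi$. For $f\in(\mathbb{C}^{2m})^*$ let $\iota_f:\bigwedge^2\mathbb{C}^{2m}\to\mathbb{C}^{2m}$ be the contraction $\iota_f(v\wedge w)=f(v)w-f(w)v$. Identify $\bigwedge^2\mathbb{C}^{2m}$ with $\mathfrak{so}_{2m}$ by sending $v\wedge w$ to the endomorphism $u\mapsto (v,u)w-(w,u)v$, and let $\mathrm{Sym}^2(\mathfrak{so}_{2m})^*$ be the space of homogeneous quadratic polynomial functions on $\mathfrak{so}_{2m}=\bigwedge^2\mathbb{C}^{2m}$,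 with the $\mathfrak{so}_{2m}$-action induced by the adjoint action. Define linear maps $$\Phi:\Big(\bigwedge\nolimits^4\mathbb{C}^{2m}\Big)^*\to \mathbb{C}\Big[\bigwedge\nolimits^2\mathbb{C}^{2m}\Big],\quad \Phi(\varphi)(\alpha)=\varphi(\alpha\wedge\alpha),$$ $$\Psi:\mathrm{Sym}^2(\mathbb{C}^{2m})^*\to \mathbb{C}\Big[\bigwedge\nolimits^2\mathbb{C}^{2m}\Big],\quad \Psi(f\cdot g)(\alpha)=(\iota_f\alpha,\iota_g\alpha),$$ which take values in quadratic functions, and let $V_{\mathrm{dec}}$ and $V_{\mathrm{iso}}$ be the images of $\Phi$ and $\Psi$. Then $\Phi$ and $\Psi$ are injective, $V_{\mathrm{dec}}$ and $V_{\mathrm{iso}}$ are subrepresentations of $\mathrm{Sym}^2(\mathfrak{so}_{2m})^*$, and $$\mathrm{Sym}^2(\mathfrak{so}_{2m})^*=V_{2\psi}^*\oplus V_{\mathrm{dec}}\oplus V_{\mathrm{iso}}$$ as $\mathfrak{so}_{2m}$-representations; that is, $\mathrm{Sym}^2(\mathfrak{so}_{2m})^*$ is the internal direct sum of $V_{\mathrm{dec}}$,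 $V_{\mathrm{iso}}$ and a subrepresentation isomorphic to the dual of $V_{2\psi}$. -/

import Mathlib

open scoped TensorProduct
open Module

attribute [local instance] LieRing.ofAssociativeRing

noncomputable section

namespace SOQuad

/-! ### The orthogonal Lie algebra -/

/-- The space `ℂ^{2m}`. -/
abbrev V (m : ℕ) : Type := Fin (2 * m) → ℂ

/-- The standard basis vectors `e_i`. -/
abbrev e {m : ℕ} (i : Fin (2 * m)) : V m := Pi.single i 1

/-- The symmetric bilinear form with `(e_i, e_j) = δ_{i, 2m+1-j}` (indices starting at `1`). -/
def form (m : ℕ) : LinearMap.BilinForm ℂ (V m) :=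
  LinearMap.mk₂ ℂ (fun v w => ∑ i, v i * w i.rev)
    (by intros; simp [add_mul, Finset.sum_add_distrib])
    (by intros; simp [mul_assoc, Finset.mul_sum])
    (by intros; simp [mul_add, Finset.sum_add_distrib])
    (by intros; simp [mul_left_comm, Finset.mul_sum])

theorem form_apply {m : ℕ} (v w : V m) : form m v w = ∑ i, v i * w i.rev := rfl

theorem form_e_left {m : ℕ} (i : Fin (2 * m)) (w : V m) : form m (e i) w = w i.rev := by
  simp [form_apply, Pi.single_apply]

theorem form_e_e {m : ℕ} (i j : Fin (2 * m)) :
    form m (e i) (e j) = if i = j.rev then 1 else 0 := by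
  simp [form_e_left, Pi.single_apply, Fin.rev_eq_iff]

theorem form_comm {m : ℕ} (v w : V m) : form m v w = form m w v := by
  rw [form_apply, form_apply, ← Equiv.sum_comp Fin.revPerm]
  simp [mul_comm]

theorem form_e_right {m : ℕ} (i : Fin (2 * m)) (w : V m) : form m w (e i) = w i.rev := by
  rw [form_comm, form_e_left]

theorem sum_form_smul {m : ℕ} (w : V m) : ∑ i : Fin (2 * m), form m w (e i) • e i.rev = w := by
  simp only [form_e_right]
  rw [← Equiv.sum_comp Fin.revPerm]
  ext j
  simp [Finset.sum_apply, Pi.single_apply]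

theorem sum_smul_e {m : ℕ} (w : V m) : ∑ i : Fin (2 * m), w i • e i = w := by
  ext j
  simp [Finset.sum_apply, Pi.single_apply]

theorem form_nondeg {m : ℕ} {v w : V m} (h : ∀ u, form m u v = form m u w) : v = w := by
  ext i
  have := h (e i.rev)
  simpa [form_e_left] using this

/-- `so_{2m}`: the endomorphisms of `ℂ^{2m}` that are skew with respect to the form. -/
abbrev so (m : ℕ) : LieSubalgebra ℂ (Module.End ℂ (V m)) :=
  skewAdjointLieSubalgebra (form m)

theorem mem_so_iff {m : ℕ} (X : Module.End ℂ (V m)) :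
    X ∈ so m ↔ ∀ v w, form m (X v) w = - form m v (X w) := by
  change X ∈ (form m).skewAdjointSubmodule ↔ _
  simp [LinearMap.mem_skewAdjointSubmodule, LinearMap.IsSkewAdjoint, LinearMap.IsAdjointPair]

/-- The `(i, j)` matrix entry of an element of `so_{2m}`. -/
def entry {m : ℕ} (X : so m) (i j : Fin (2 * m)) : ℂ := LinearMap.toMatrix' X.1 i j

theorem entry_eq {m : ℕ} (X : so m) (i j : Fin (2 * m)) : entry X i j = X.1 (e j) i := by
  simp [entry, LinearMap.toMatrix'_apply]

theorem entry_zero {m : ℕ} (i j : Fin (2 * m)) : entry (0 : so m) i j = 0 := by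
  simp [entry]

theorem entry_add {m : ℕ} (X Y : so m) (i j : Fin (2 * m)) :
    entry (X + Y) i j = entry X i j + entry Y i j := by
  simp [entry]

theorem entry_smul {m : ℕ} (c : ℂ) (X : so m) (i j : Fin (2 * m)) :
    entry (c • X) i j = c * entry X i j := by
  simp [entry]

theorem entry_lie {m : ℕ} (X Y : so m) (i j : Fin (2 * m)) :
    entry ⁅X, Y⁆ i j = ∑ k, entry X i k * entry Y k j - ∑ k, entry Y i k * entry X k j := by
  simp only [entry, LieSubalgebra.coe_bracket, Ring.lie_def, map_sub, Matrix.sub_apply,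
    LinearMap.toMatrix'_mul, Matrix.mul_apply]

/-- The Cartan subalgebra of diagonal matrices. -/
def cartan (m : ℕ) : LieSubalgebra ℂ (so m) where
  carrier := {X | ∀ i j : Fin (2 * m), i ≠ j → entry X i j = 0}
  add_mem' hX hY i j hij := by rw [entry_add, hX i j hij, hY i j hij, add_zero]
  zero_mem' i j _ := entry_zero i j
  smul_mem' c X hX i j hij := by rw [entry_smul, hX i j hij, mul_zero]
  lie_mem' := by
    have key : ∀ A B : so m, (∀ i j : Fin (2 * m), i ≠ j → entry A i j = 0) →
        (∀ i j : Fin (2 * m), i ≠ j → entry B i j = 0) → ∀ i j : Fin (2 * m), i ≠ j →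
        ∑ k, entry A i k * entry B k j = 0 := by
      intro A B hA hB i j hij
      refine Finset.sum_eq_zero fun k _ => ?_
      by_cases hk : i = k
      · subst hk; rw [hB i j hij, mul_zero]
      · rw [hA i k hk, zero_mul]
    intro X Y hX hY i j hij
    rw [entry_lie, key X Y hX hY i j hij, key Y X hY hX i j hij, sub_zero]

/-- The nilpotent subalgebra `𝔫` (the sum of the positive root spaces) of strictly upper
triangular matrices. -/
def nilp (m : ℕ) : LieSubalgebra ℂ (so m) where
  carrier := {X | ∀ i j : Fin (2 * m), j ≤ i → entry X i j = 0}
  add_mem' hX hY i j hij := by rw [entry_add, hX i j hij, hY i j hij, add_zero]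
  zero_mem' i j _ := entry_zero i j
  smul_mem' c X hX i j hij := by rw [entry_smul, hX i j hij, mul_zero]
  lie_mem' := by
    have key : ∀ A B : so m, (∀ i j : Fin (2 * m), j ≤ i → entry A i j = 0) →
        (∀ i j : Fin (2 * m), j ≤ i → entry B i j = 0) → ∀ i j : Fin (2 * m), j ≤ i →
        ∑ k, entry A i k * entry B k j = 0 := by
      intro A B hA hB i j hij
      refine Finset.sum_eq_zero fun k _ => ?_
      by_cases hk : k ≤ i
      · rw [hA i k hk, zero_mul]
      · rw [hB k j (hij.trans (le_of_not_ge hk)), mul_zero]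
    intro X Y hX hY i j hij
    rw [entry_lie, key X Y hX hY i j hij, key Y X hY hX i j hij, sub_zero]

/-! ### Highest weights -/

/-- `W` has a nonzero vector of weight `μ` annihilated by `𝔫`. -/
def HasHighestWeightVector (m : ℕ) (W : Type*) [AddCommGroup W] [Module ℂ W]
    [LieRingModule (so m) W] (μ : Dual ℂ (cartan m)) : Prop :=
  ∃ w : W, w ≠ 0 ∧ (∀ H : cartan m, ⁅(H : so m), w⁆ = μ H • w) ∧
    ∀ X ∈ nilp m, ⁅X, w⁆ = 0

/-- `W` is a (finite-dimensional) irreducible representation of `so_{2m}` of highest weight `μ`,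
i.e. `W` is a model of `V_μ`. -/
structure IsIrrepOfHighestWeight (m : ℕ) (W : Type*) [AddCommGroup W] [Module ℂ W]
    [LieRingModule (so m) W] [LieModule ℂ (so m) W] (μ : Dual ℂ (cartan m)) : Prop where
  finiteDimensional : FiniteDimensional ℂ W
  irreducible : LieModule.IsIrreducible ℂ (so m) W
  highestWeight : HasHighestWeightVector m W μ

/-- The weight `ε_i` of the Cartan subalgebra, taking a diagonal matrix to its `i`-th entry. -/
def eps {m : ℕ} (i : Fin (2 * m)) : Dual ℂ (cartan m) where
  toFun H := entry (H : so m) i i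
  map_add' _ _ := entry_add _ _ i i
  map_smul' c _ := entry_smul c _ i i

/-- The highest root `ψ = ε₁ + ε₂` of `so_{2m}` (see `highestRoot_spec`). -/
def highestRoot (m : ℕ) (hm : 4 ≤ m) : Dual ℂ (cartan m) :=
  eps ⟨0, by omega⟩ + eps ⟨1, by omega⟩

/-! ### Bivectors and `so_{2m}` -/

/-- The bivector `v ∧ w`. -/
def wedge {m : ℕ} (v w : V m) : ⋀[ℂ]^2 (V m) := exteriorPower.ιMulti ℂ 2 ![v, w]

theorem coe_wedge {m : ℕ} (v w : V m) :
    (wedge v w : ExteriorAlgebra ℂ (V m)) = ExteriorAlgebra.ι ℂ v * ExteriorAlgebra.ι ℂ w := by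
  simp [wedge, ExteriorAlgebra.ιMulti_apply]

theorem wedge_ext {m : ℕ} {N : Type*} [AddCommGroup N] [Module ℂ N]
    {f g : ⋀[ℂ]^2 (V m) →ₗ[ℂ] N} (h : ∀ v w, f (wedge v w) = g (wedge v w)) : f = g := by
  apply exteriorPower.linearMap_ext
  ext a
  have : a = ![a 0, a 1] := by ext i : 1; fin_cases i <;> rfl
  rw [this]
  exact h _ _

/-- The bilinear map `(v, w) ↦ v ∧ w`. -/
def wedgeₗ (m : ℕ) : V m →ₗ[ℂ] V m →ₗ[ℂ] ⋀[ℂ]^2 (V m) :=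
  LinearMap.mk₂ ℂ wedge
    (by intros; apply Subtype.ext; simp [coe_wedge, add_mul])
    (by intros; apply Subtype.ext; simp [coe_wedge])
    (by intros; apply Subtype.ext; simp [coe_wedge, mul_add])
    (by intros; apply Subtype.ext; simp [coe_wedge])

theorem wedgeₗ_apply {m : ℕ} (v w : V m) : wedgeₗ m v w = wedge v w := rfl

theorem wedge_swap {m : ℕ} (v w : V m) : wedge v w = - wedge w v := by
  apply Subtype.ext
  simp only [coe_wedge, NegMemClass.coe_neg]
  exact eq_neg_of_add_eq_zero_left (ExteriorAlgebra.ι_add_mul_swap v w)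

/-- The contraction `ι_f α ∈ ℂ^{2m}` of a bivector `α` by a covector `f`; on `v ∧ w` it is
`f(v) w - f(w) v`. -/
def contract (m : ℕ) : Dual ℂ (V m) →ₗ[ℂ] ⋀[ℂ]^2 (V m) →ₗ[ℂ] V m :=
  LinearMap.mk₂ ℂ
    (fun f α => ExteriorAlgebra.ιInv (CliffordAlgebra.contractLeft f (α : ExteriorAlgebra ℂ (V m))))
    (by intros; simp) (by intros; simp) (by intros; simp) (by intros; simp)

theorem contract_wedge {m : ℕ} (f : Dual ℂ (V m)) (v w : V m) :
    contract m f (wedge v w) = f v • w - f w • v := by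
  simp only [contract, LinearMap.mk₂_apply, coe_wedge]
  unfold ExteriorAlgebra.ι
  rw [CliffordAlgebra.contractLeft_ι_mul, CliffordAlgebra.contractLeft_ι, ← Algebra.commutes,
    ← Algebra.smul_def, map_sub, map_smul, map_smul]
  have := ExteriorAlgebra.ι_leftInverse (R := ℂ) (M := V m)
  erw [this v, this w]

/-- The endomorphism `φ_α : u ↦ ι_{(·, u)} α`; for `α = v ∧ w` it is `u ↦ (v, u) w - (w, u) v`. -/
def bivectorEnd (m : ℕ) : ⋀[ℂ]^2 (V m) →ₗ[ℂ] Module.End ℂ (V m) :=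
  LinearMap.flip ((contract m).comp (form m).flip)

theorem bivectorEnd_wedge {m : ℕ} (v w u : V m) :
    bivectorEnd m (wedge v w) u = form m v u • w - form m w u • v := by
  simp [bivectorEnd, contract_wedge]

theorem bivectorEnd_mem {m : ℕ} (α : ⋀[ℂ]^2 (V m)) : bivectorEnd m α ∈ so m := by
  rw [mem_so_iff]
  intro v w
  have : (((form m).flip w) ∘ₗ (LinearMap.applyₗ v) ∘ₗ bivectorEnd m) =
      - ((form m v) ∘ₗ (LinearMap.applyₗ w) ∘ₗ bivectorEnd m) := by
    apply wedge_ext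
    intro a b
    simp [bivectorEnd_wedge, form_comm v]
    ring
  exact LinearMap.congr_fun this α

/-- The bivector `½ ∑ e_{i'} ∧ X e_i` attached to `X ∈ so_{2m}`, where `i' = 2m + 1 - i`. -/
def toBivector (m : ℕ) : so m →ₗ[ℂ] ⋀[ℂ]^2 (V m) where
  toFun X := (2⁻¹ : ℂ) • ∑ i : Fin (2 * m), wedge (e i.rev) (X.1 (e i))
  map_add' X Y := by
    simp [← wedgeₗ_apply, Finset.sum_add_distrib]
  map_smul' c X := by
    simp only [← wedgeₗ_apply, SetLike.val_smul, LinearMap.smul_apply, map_smul, RingHom.id_apply,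
      ← Finset.smul_sum]
    rw [smul_comm]

/-- The identification `⋀² ℂ^{2m} = so_{2m}`,
`v ∧ w ↦ (u ↦ (v, u) w - (w, u) v)`. -/
def bivectorEquiv (m : ℕ) : ⋀[ℂ]^2 (V m) ≃ₗ[ℂ] so m :=
  LinearEquiv.ofLinearMap ((bivectorEnd m).codRestrict (so m).toSubmodule bivectorEnd_mem)
    (toBivector m)
    (by
      ext X : 1
      apply Subtype.ext
      have hX := (mem_so_iff X.1).1 X.2
      refine LinearMap.ext fun u => ?_
      change bivectorEnd m ((2⁻¹ : ℂ) • ∑ i : Fin (2 * m), wedge (e i.rev) (X.1 (e i))) u = X.1 u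
      have h1 : ∑ i : Fin (2 * m), form m (e i.rev) u • X.1 (e i) = X.1 u := by
        conv_rhs => rw [← sum_smul_e u, map_sum]
        simp [form_e_left]
      have h2 : ∑ i : Fin (2 * m), form m (X.1 (e i)) u • e i.rev = - X.1 u := by
        conv_rhs => rw [← sum_form_smul (X.1 u), ← Finset.sum_neg_distrib]
        refine Finset.sum_congr rfl fun i _ => ?_
        rw [hX, form_comm (e i), neg_smul]
      simp only [map_smul, map_sum, LinearMap.smul_apply, LinearMap.sum_apply, bivectorEnd_wedge,
        Finset.sum_sub_distrib, h1, h2, sub_neg_eq_add, ← two_smul ℂ (X.1 u), smul_smul]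
      norm_num)
    (by
      apply wedge_ext
      intro v w
      change (2⁻¹ : ℂ) • ∑ i : Fin (2 * m), wedge (e i.rev) (bivectorEnd m (wedge v w) (e i))
        = wedge v w
      have h : ∀ a b : V m, ∑ i : Fin (2 * m), wedge (e i.rev) (form m a (e i) • b) = wedge a b := by
        intro a b
        conv_rhs => rw [← sum_form_smul a, ← wedgeₗ_apply, map_sum, LinearMap.sum_apply]
        simp [← wedgeₗ_apply]
      simp only [bivectorEnd_wedge]
      simp only [← wedgeₗ_apply, map_sub, Finset.sum_sub_distrib]
      simp only [wedgeₗ_apply, h]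
      rw [wedge_swap w v, sub_neg_eq_add, ← two_smul ℂ, smul_smul]
      norm_num)

theorem bivectorEquiv_wedge {m : ℕ} (v w u : V m) :
    (bivectorEquiv m (wedge v w)).1 u = form m v u • w - form m w u • v :=
  bivectorEnd_wedge v w u

/-- The identification `⋀² ℂ^{2m} = so_{2m}` is equivariant. -/
theorem lie_bivectorEquiv_wedge {m : ℕ} (X : so m) (v w : V m) :
    ⁅X, bivectorEquiv m (wedge v w)⁆ =
      bivectorEquiv m (wedge (X.1 v) w) + bivectorEquiv m (wedge v (X.1 w)) := by
  have hX := (mem_so_iff X.1).1 X.2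
  apply Subtype.ext
  refine LinearMap.ext fun u => ?_
  simp only [LieSubalgebra.coe_bracket, Ring.lie_def, LinearMap.sub_apply, Module.End.mul_apply,
    AddMemClass.coe_add, LinearMap.add_apply, bivectorEquiv_wedge, map_sub, map_smul, hX, neg_smul]
  abel

/-- The highest root is the weight of the root vector `e₁ ∧ e₂`, which is killed by `𝔫`. -/
theorem highestRoot_spec (m : ℕ) (hm : 4 ≤ m) :
    HasHighestWeightVector m (so m) (highestRoot m hm) := by
  have h0 : 0 < 2 * m := by omega
  have h1 : 1 < 2 * m := by omega
  refine ⟨bivectorEquiv m (wedge (e ⟨0, h0⟩) (e ⟨1, h1⟩)), ?_, ?_, ?_⟩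
  · intro h
    have := congrArg (fun X : so m => X.1 (e (Fin.rev ⟨0, h0⟩)) ⟨1, h1⟩) h
    simp [bivectorEquiv_wedge, form_e_e] at this
  · intro H
    have hd : ∀ j, (H : so m).1 (e j) = entry (H : so m) j j • e j := by
      intro j
      ext i
      rw [← entry_eq]
      by_cases hij : i = j
      · subst hij; simp
      · rw [H.2 i j hij]; simp [hij]
    rw [lie_bivectorEquiv_wedge, hd, hd, ← map_add, ← wedgeₗ_apply, ← wedgeₗ_apply, map_smul,
      map_smul, LinearMap.smul_apply, ← add_smul, map_smul]
    rfl
  · intro X hX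
    have z0 : X.1 (e ⟨0, h0⟩) = 0 := by
      ext i
      rw [← entry_eq, hX i _ (Fin.mk_le_of_le_val (Nat.zero_le _))]; rfl
    have z1 : X.1 (e ⟨1, h1⟩) = entry X ⟨0, h0⟩ ⟨1, h1⟩ • e ⟨0, h0⟩ := by
      ext i
      rw [← entry_eq]
      by_cases hi : i = ⟨0, h0⟩
      · subst hi; simp
      · rw [hX i _ (by
          have : i.1 ≠ 0 := fun h => hi (Fin.ext h)
          exact Fin.mk_le_of_le_val (by omega))]
        simp [hi]
    have hs : wedge (e ⟨0, h0⟩ : V m) (e ⟨0, h0⟩) = 0 := by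
      apply Subtype.ext
      rw [coe_wedge, ExteriorAlgebra.ι_sq_zero]
      rfl
    rw [lie_bivectorEquiv_wedge, z0, z1, ← wedgeₗ_apply, ← wedgeₗ_apply, map_smul, wedgeₗ_apply, wedgeₗ_apply, hs]
    simp [← wedgeₗ_apply]

/-! ### Quadratic functions as a representation -/

section QuadraticAction

variable {R L M : Type*} [CommRing R] [LieRing L] [LieAlgebra R L] [AddCommGroup M] [Module R M]
  [LieRingModule L M] [LieModule R L M]

/-- The quadratic form `X · q`, with `(X · q)(y) = - polar q (y, X · y)`; this is the derivative at
`t = 0` of `q (exp (-t X) y)`. -/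
def quadLie (X : L) (q : QuadraticForm R M) : QuadraticForm R M :=
  - LinearMap.BilinMap.toQuadraticMap (q.polarBilin.compl₂ (LieModule.toEnd R L M X))

theorem quadLie_apply (X : L) (q : QuadraticForm R M) (y : M) :
    quadLie X q y = - QuadraticMap.polar q y ⁅X, y⁆ := rfl

theorem polar_quadLie (X : L) (q : QuadraticForm R M) (y z : M) :
    QuadraticMap.polar (quadLie X q) y z =
      - (QuadraticMap.polar q y ⁅X, z⁆ + QuadraticMap.polar q z ⁅X, y⁆) := by
  rw [QuadraticMap.polar, quadLie_apply, quadLie_apply, quadLie_apply]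
  simp only [lie_add, QuadraticMap.polar_add_left, QuadraticMap.polar_add_right]
  ring

/-- The space of quadratic forms on a representation `M`, i.e. `Sym² (M^*)`, is a representation. -/
instance quadLieRingModule : LieRingModule L (QuadraticForm R M) where
  bracket := quadLie
  add_lie X Y q := by
    ext y
    simp [quadLie_apply, QuadraticMap.polar_add_right, add_comm]
  lie_add X q r := by
    ext y
    simp [quadLie_apply, QuadraticMap.polar_add, add_comm]
  leibniz_lie X Y q := by
    ext y
    rw [_root_.add_apply, quadLie_apply, quadLie_apply, quadLie_apply, polar_quadLie,
      polar_quadLie, lie_lie, QuadraticMap.polar_sub_right,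
      QuadraticMap.polar_comm q ⁅Y, y⁆]
    ring

theorem lie_quad_apply (X : L) (q : QuadraticForm R M) (y : M) :
    ⁅X, q⁆ y = - QuadraticMap.polar q y ⁅X, y⁆ := rfl

instance quadLieModule : LieModule R L (QuadraticForm R M) where
  smul_lie c X q := by
    ext y
    simp [lie_quad_apply, QuadraticMap.polar_smul_right]
  lie_smul c X q := by
    ext y
    simp [lie_quad_apply, QuadraticMap.polar_smul]

end QuadraticAction

/-! ### The maps `Φ` and `Ψ` -/

/-- The exterior product `⋀² × ⋀² → ⋀⁴`. -/
def wedge₂₂ (m : ℕ) : LinearMap.BilinMap ℂ (⋀[ℂ]^2 (V m)) (⋀[ℂ]^4 (V m)) :=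
  LinearMap.mk₂ ℂ
    (fun α β => ⟨(α : ExteriorAlgebra ℂ (V m)) * (β : ExteriorAlgebra ℂ (V m)), by
      have := Submodule.mul_mem_mul α.2 β.2
      rwa [← pow_add] at this⟩)
    (by intros; apply Subtype.ext; simp [add_mul])
    (by intros; apply Subtype.ext; simp)
    (by intros; apply Subtype.ext; simp [mul_add])
    (by intros; apply Subtype.ext; simp)

/-- `Φ : (⋀⁴ ℂ^{2m})^* → ℂ[⋀² ℂ^{2m}]`, `φ ↦ (α ↦ φ(α ∧ α))`; its values are quadratic forms. -/
def Phi (m : ℕ) : Dual ℂ (⋀[ℂ]^4 (V m)) →ₗ[ℂ] QuadraticForm ℂ (⋀[ℂ]^2 (V m)) where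
  toFun φ := LinearMap.BilinMap.toQuadraticMap ((wedge₂₂ m).compr₂ φ)
  map_add' φ χ := by ext; simp
  map_smul' c φ := by ext; simp

theorem Phi_apply {m : ℕ} (φ : Dual ℂ (⋀[ℂ]^4 (V m))) (α : ⋀[ℂ]^2 (V m)) :
    Phi m φ α = φ (wedge₂₂ m α α) := rfl

/-- The linear map out of a symmetric power induced by a symmetric multilinear map. -/
def symLift {R ι : Type} {M N : Type*} [CommSemiring R] [AddCommMonoid M] [Module R M]
    [AddCommMonoid N] [Module R N] (f : MultilinearMap R (fun _ : ι => M) N)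
    (hf : ∀ (σ : Equiv.Perm ι) (a : ι → M), f (fun i => a (σ i)) = f a) :
    SymmetricPower R ι M →ₗ[R] N where
  toFun := AddCon.lift (addConGen (SymmetricPower.Rel R ι M))
    (PiTensorProduct.lift f).toAddMonoidHom
    (AddCon.addConGen_le.2 fun x y h => by
      cases h with
      | perm σ a => simpa [AddCon.ker_rel] using (hf σ a).symm)
  map_add' := map_add _
  map_smul' c x := by
    induction x using AddCon.induction_on with
    | H x => exact map_smul (PiTensorProduct.lift f) c x

theorem symLift_tprod {R ι : Type} {M N : Type*} [CommSemiring R] [AddCommMonoid M] [Module R M]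
    [AddCommMonoid N] [Module R N] (f : MultilinearMap R (fun _ : ι => M) N)
    (hf : ∀ (σ : Equiv.Perm ι) (a : ι → M), f (fun i => a (σ i)) = f a) (a : ι → M) :
    symLift f hf (SymmetricPower.tprod R a) = f a :=
  PiTensorProduct.lift.tprod a

/-- `(f, g) ↦ (α ↦ (ι_f α, ι_g α))` as a multilinear map on pairs of covectors. -/
def psiMultilinear (m : ℕ) :
    MultilinearMap ℂ (fun _ : Fin 2 => Dual ℂ (V m)) (QuadraticForm ℂ (⋀[ℂ]^2 (V m))) :=
  MultilinearMap.mk'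
    (fun a => LinearMap.BilinMap.toQuadraticMap
      ((form m).compl₁₂ (contract m (a 0)) (contract m (a 1))))
    (by
      intro a i x y
      ext α
      fin_cases i <;> simp)
    (by
      intro a i c x
      ext α
      fin_cases i <;> simp)

theorem psiMultilinear_apply {m : ℕ} (a : Fin 2 → Dual ℂ (V m)) (α : ⋀[ℂ]^2 (V m)) :
    psiMultilinear m a α = form m (contract m (a 0) α) (contract m (a 1) α) := rfl

theorem psiMultilinear_symm {m : ℕ} (σ : Equiv.Perm (Fin 2)) (a : Fin 2 → Dual ℂ (V m)) :
    psiMultilinear m (fun i => a (σ i)) = psiMultilinear m a := by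
  refine QuadraticMap.ext fun α => ?_
  rw [psiMultilinear_apply, psiMultilinear_apply]
  fin_cases σ
  · rfl
  · exact form_comm _ _

/-- `Ψ : Sym² (ℂ^{2m})^* → ℂ[⋀² ℂ^{2m}]`, `f · g ↦ (α ↦ (ι_f α, ι_g α))`; its values are quadratic
forms. -/
def Psi (m : ℕ) : Sym[ℂ]^2 (Dual ℂ (V m)) →ₗ[ℂ] QuadraticForm ℂ (⋀[ℂ]^2 (V m)) :=
  symLift (psiMultilinear m) psiMultilinear_symm

theorem Psi_apply {m : ℕ} (f g : Dual ℂ (V m)) (α : ⋀[ℂ]^2 (V m)) :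
    Psi m (SymmetricPower.tprod ℂ ![f, g]) α = form m (contract m f α) (contract m g α) := by
  rw [Psi, symLift_tprod, psiMultilinear_apply]
  rfl

/-- Transport of quadratic forms along `⋀² ℂ^{2m} = so_{2m}`. -/
def transport (m : ℕ) : QuadraticForm ℂ (⋀[ℂ]^2 (V m)) →ₗ[ℂ] QuadraticForm ℂ (so m) where
  toFun q := q.comp (bivectorEquiv m).symm.toLinearMap
  map_add' _ _ := rfl
  map_smul' _ _ := rfl

/-- `V_dec`, the image of `Φ`, as a space of quadratic forms on `so_{2m} = ⋀² ℂ^{2m}`. -/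
def Vdec (m : ℕ) : Submodule ℂ (QuadraticForm ℂ (so m)) := (LinearMap.range (Phi m)).map (transport m)

/-- `V_iso`, the image of `Ψ`, as a space of quadratic forms on `so_{2m} = ⋀² ℂ^{2m}`. -/
def Viso (m : ℕ) : Submodule ℂ (QuadraticForm ℂ (so m)) := (LinearMap.range (Psi m)).map (transport m)

end SOQuad

end

/-!
A quadratic form `q` on `so_{2m} = ⋀² ℂ^{2m}` is an algebraic curvature tensor, except that the
Bianchi identity may fail: its components are the values `R(u, v, x, y)` of the symmetric bilinear
form of `q` at `(u ∧ v, x ∧ y)`. The space `V_dec` consists of the totally antisymmetric tensors,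
and a projection onto it is given by the Bianchi sum. The space `V_iso` consists of the products of
symmetric bilinear forms `h` with the standard form `(·, ·)`; it satisfies the Bianchi identity,
and its Ricci contraction `(2m - 2) h + (tr h) (·, ·)` determines `h`. The complement is therefore
the space `C` of tensors of Weyl type, with vanishing Bianchi sum and Ricci contraction.

A tensor of Weyl type which vanishes on all isotropic planes is zero: for `u` isotropic the Jacobi
form `R(u, ·, u, ·)` is a multiple of `(·, ·)` on the orthogonal space of `u`, and the multiple is
zero because the Ricci contraction vanishes. Exponentials of nilpotent elements of `so_{2m}` move
any isotropic plane to any other, so a nonzero subrepresentation `N` of `C` contains some `q` with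
`q (a ∧ b) ≠ 0` for a given isotropic plane `a, b`. The fourth power of `a ∧ b` sends `q` to a
nonzero multiple of the square of the linear form `tr (a ∧ b ·)`, which hence lies in every such
`N`. Pairing with this square under the invariant trace form of quadratic forms is evaluation at
`a ∧ b`, so it is not orthogonal to `N`, whereas it would lie in `N ∩ N^⊥ ∩ C` if `N ≠ C`.

Evaluation at the highest root vector is a highest weight vector of weight `2ψ` in the dual of `C`.
Two irreducible representations `M` and `N` with this highest weight are isomorphic because the
subrepresentation of `M × N` generated by the pair of highest weight vectors is a graph: the top
eigenspace of a grading element on it is a line, which meets neither factor.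
-/

noncomputable section

namespace SOQuad

theorem isInternal_of_existsUnique_sum {R M : Type*} [Ring R] [AddCommGroup M] [Module R M]
    {A B C : Submodule R M} (hexists : ∀ x, ∃ a ∈ A, ∃ b ∈ B, ∃ c ∈ C, a + b + c = x)
    (hunique : ∀ {a b c}, a ∈ A → b ∈ B → c ∈ C → a + b + c = 0 → a = 0 ∧ b = 0 ∧ c = 0) :
    DirectSum.IsInternal ![A, B, C] := by
  refine DirectSum.isInternal_submodule_of_iSupIndep_of_iSup_eq_top
    ((iSupIndep_iff_finsetSum_eq_zero_imp_eq_zero _).mpr fun s v hmem hsum i hi => ?_)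
    (eq_top_iff.mpr fun x _ => ?_)
  · let w (i : Fin 3) : M := if i ∈ s then v i else 0
    have hw (i : Fin 3) : w i ∈ ![A, B, C] i := by
      by_cases his : i ∈ s
      · simpa only [w, if_pos his] using hmem i his
      · simpa only [w, if_neg his] using zero_mem _
    have hw_sum : w 0 + w 1 + w 2 = 0 := by
      rw [← Fin.sum_univ_three, Finset.sum_ite_mem, Finset.univ_inter, hsum]
    obtain ⟨h₀, h₁, h₂⟩ := hunique (hw 0) (hw 1) (hw 2) hw_sum
    have hwi : w i = 0 := by fin_cases i <;> assumption
    simpa only [w, if_pos hi] using hwi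
  · obtain ⟨a, ha, b, hb, c, hc, rfl⟩ := hexists x
    exact add_mem (add_mem (Submodule.mem_iSup_of_mem 0 ha) (Submodule.mem_iSup_of_mem 1 hb))
      (Submodule.mem_iSup_of_mem 2 hc)

/-! ### Representations on quadratic forms -/

section LieActionOnQuadraticForms

variable {R L M : Type*} [CommRing R] [Invertible (2 : R)] [AddCommGroup M] [Module R M]

theorem two_mul_associated (q : QuadraticForm R M) (y z : M) :
    2 * QuadraticMap.associated q y z = QuadraticMap.polar q y z := by
  simpa [two_mul, two_nsmul] using
    LinearMap.congr_fun₂ (QuadraticMap.two_nsmul_associated R q) y z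

variable [LieRing L] [LieAlgebra R L] [LieRingModule L M] [LieModule R L M]

theorem lie_quad_apply_eq_associated (X : L) (q : QuadraticForm R M) (y : M) :
    ⁅X, q⁆ y = -(2 * QuadraticMap.associated q y ⁅X, y⁆) := by
  rw [lie_quad_apply, two_mul_associated]

theorem associated_lie (X : L) (q : QuadraticForm R M) (y z : M) :
    QuadraticMap.associated ⁅X, q⁆ y z =
      -(QuadraticMap.associated q ⁅X, y⁆ z + QuadraticMap.associated q y ⁅X, z⁆) := by
  refine (isUnit_of_invertible (2 : R)).mul_left_cancel ?_
  rw [mul_neg, mul_add, two_mul_associated, two_mul_associated, two_mul_associated,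
    QuadraticMap.polar_comm q ⁅X, y⁆, add_comm]
  exact polar_quadLie X q y z

end LieActionOnQuadraticForms

section NilpotentAction

variable {K L M : Type*} [Field K] [CharZero K] [LieRing L] [LieAlgebra K L] [AddCommGroup M]
  [Module K M] [LieRingModule L M] [LieModule K L M]

theorem lie_lie_lie_lie_quad_apply {X : L} {y : M} (h : ⁅X, ⁅X, ⁅X, y⁆⁆⁆ = 0)
    (q : QuadraticForm K M) : ⁅X, ⁅X, ⁅X, ⁅X, q⁆⁆⁆⁆ y = 6 * q ⁅X, ⁅X, y⁆⁆ := by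
  rw [← QuadraticMap.associated_eq_self_apply K q, lie_quad_apply_eq_associated]
  simp only [associated_lie, h, map_zero, LinearMap.zero_apply]
  ring

/-- Since `exp X` acts on quadratic forms by composition with `exp (-X)`, both sides are the value
at `y` of `exp (-X) • q`. -/
theorem quad_exp_apply {X : L} {y : M} (h : ⁅X, ⁅X, ⁅X, y⁆⁆⁆ = 0) (q : QuadraticForm K M) :
    q (y + ⁅X, y⁆ + (2 : K)⁻¹ • ⁅X, ⁅X, y⁆⁆) = q y - ⁅X, q⁆ y + ⁅X, ⁅X, q⁆⁆ y / 2 -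
      ⁅X, ⁅X, ⁅X, q⁆⁆⁆ y / 6 + ⁅X, ⁅X, ⁅X, ⁅X, q⁆⁆⁆⁆ y / 24 := by
  have hself : ∀ z, q z = QuadraticMap.associated q z z :=
    fun z => (QuadraticMap.associated_eq_self_apply K q z).symm
  have hcomm : ∀ z w, QuadraticMap.associated q z w = QuadraticMap.associated q w z :=
    QuadraticMap.associated_isSymm K q
  rw [lie_lie_lie_lie_quad_apply h]
  simp only [hself (_ + _), hself y, hself ⁅X, ⁅X, y⁆⁆, lie_quad_apply_eq_associated,
    associated_lie, h, map_zero, map_add, map_smul, LinearMap.add_apply, LinearMap.smul_apply,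
    smul_eq_mul]
  rw [hcomm ⁅X, y⁆ y, hcomm ⁅X, ⁅X, y⁆⁆ y, hcomm ⁅X, ⁅X, y⁆⁆ ⁅X, y⁆]
  field

end NilpotentAction

section EvalDual

variable {R L M : Type*} [CommRing R] [LieRing L] [LieAlgebra R L] [AddCommGroup M] [Module R M]
  [LieRingModule L M] [LieModule R L M]

/-- Evaluation at `y`, as a functional on a subrepresentation of the quadratic forms. -/
def evalDual (C : LieSubmodule R L (QuadraticForm R M)) (y : M) : Dual R C where
  toFun q := (q : QuadraticForm R M) y
  map_add' _ _ := rfl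
  map_smul' _ _ := rfl

theorem lie_evalDual {C : LieSubmodule R L (QuadraticForm R M)} {X : L} {y : M} {c : R}
    (h : ⁅X, y⁆ = c • y) : ⁅X, evalDual C y⁆ = (2 * c) • evalDual C y := by
  ext q
  change -(⁅X, (q : QuadraticForm R M)⁆ y) = 2 * c * (q : QuadraticForm R M) y
  rw [lie_quad_apply, h, QuadraticMap.polar_smul_right, QuadraticMap.polar_self, neg_neg,
    smul_eq_mul, two_smul]
  ring

end EvalDual

/-! ### Invariant forms and irreducibility -/

section InvariantForm

variable {K L M : Type*} [Field K] [AddCommGroup M] [Module K M]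

section QuadPairing

variable [Invertible (2 : K)] [FiniteDimensional K M] {B : LinearMap.BilinForm K M}

instance : FiniteDimensional K (QuadraticForm K M) :=
  Module.Finite.of_injective (QuadraticMap.associated (R := K) (M := M))
    (QuadraticMap.associated_rightInverse K).injective

/-- The endomorphism representing the polar form of a quadratic form with respect to a nondegenerate
bilinear form `B`. -/
def quadEndo (hB : B.Nondegenerate) : QuadraticForm K M →ₗ[K] Module.End K M :=
  (B.toDual hB).symm.toLinearMap.compRight K ∘ₗ QuadraticMap.associatedHom K

theorem apply_quadEndo (hB : B.Nondegenerate) (q : QuadraticForm K M) (y z : M) :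
    B (quadEndo hB q y) z = QuadraticMap.associated q y z :=
  LinearMap.BilinForm.apply_toDual_symm_apply (hB := hB) ..

/-- The pairing `(q, r) ↦ tr (qr)` of quadratic forms, regarded as endomorphisms by means of a
nondegenerate bilinear form. -/
def quadPairing (hB : B.Nondegenerate) : LinearMap.BilinForm K (QuadraticForm K M) :=
  ((LinearMap.mul K (Module.End K M)).compl₁₂ (quadEndo hB) (quadEndo hB)).compr₂
    (LinearMap.trace K M)

theorem quadPairing_apply (hB : B.Nondegenerate) (q r : QuadraticForm K M) :
    quadPairing hB q r = LinearMap.trace K M (quadEndo hB q * quadEndo hB r) := rfl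

theorem quadEndo_eq_iff (hB : B.Nondegenerate) {q : QuadraticForm K M} {f : Module.End K M} :
    quadEndo hB q = f ↔ ∀ y z, QuadraticMap.associated q y z = B (f y) z := by
  refine ⟨fun h y z => by rw [← h, apply_quadEndo], fun h => LinearMap.ext fun y => ?_⟩
  exact (B.toDual hB).injective (LinearMap.ext fun z => (apply_quadEndo hB q y z).trans (h y z))

theorem quadPairing_linMulLin (hB : B.Nondegenerate) (hsymm : B.IsSymm) (q : QuadraticForm K M)
    (x : M) : quadPairing hB q (QuadraticMap.linMulLin (B x) (B x)) = q x := by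
  have hsq : quadEndo hB (QuadraticMap.linMulLin (B x) (B x)) = (B x).smulRight x := by
    refine (quadEndo_eq_iff hB).2 fun y z => ?_
    rw [QuadraticMap.associated_linMulLin, ← two_smul K, invOf_smul_smul]
    simp
  have hcomp : quadEndo hB q * (B x).smulRight x = (B x).smulRight (quadEndo hB q x) :=
    LinearMap.ext fun y => by simp
  rw [quadPairing_apply, hsq, hcomp, LinearMap.trace_smulRight, hsymm.eq, apply_quadEndo,
    QuadraticMap.associated_eq_self_apply]

variable [LieRing L] [LieAlgebra K L] [LieRingModule L M] [LieModule K L M]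

theorem quadEndo_lie (hB : B.Nondegenerate) (hinv : B.lieInvariant L) (X : L)
    (q : QuadraticForm K M) : quadEndo hB ⁅X, q⁆ = ⁅LieModule.toEnd K L M X, quadEndo hB q⁆ := by
  rw [quadEndo_eq_iff]
  intro y z
  rw [associated_lie, Ring.lie_def]
  simp [hinv X, apply_quadEndo]
  ring

theorem quadPairing_lieInvariant (hB : B.Nondegenerate) (hinv : B.lieInvariant L) :
    (quadPairing hB).lieInvariant L := by
  intro X q r
  have h := LinearMap.trace_mul_comm K (LieModule.toEnd K L M X) (quadEndo hB q * quadEndo hB r)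
  simp only [quadPairing_apply, quadEndo_lie hB hinv, Ring.lie_def, sub_mul, mul_sub, map_sub,
    mul_assoc] at h ⊢
  linear_combination h

end QuadPairing

variable [LieRing L] [LieRingModule L M]
  {W : LieSubmodule K L M}

theorem isAtom_of_lieInvariant [FiniteDimensional K W] {Φ : LinearMap.BilinForm K M}
    (hΦ : Φ.lieInvariant L) (hW : W ≠ ⊥) {s : M}
    (h : ∀ N ≤ W, N ≠ ⊥ → s ∈ N ∧ ∃ q ∈ N, Φ q s ≠ 0) : IsAtom W := by
  refine ⟨hW, fun N hN => by_contra fun hN0 => hN.ne ?_⟩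
  obtain ⟨-, q, hq, hqs⟩ := h N hN.le hN0
  have hperp : LieAlgebra.InvariantForm.orthogonal Φ hΦ N ⊓ W = ⊥ := by
    by_contra hP
    have hs := (h _ inf_le_right hP).1.1
    exact hqs ((LieAlgebra.InvariantForm.mem_orthogonal Φ hΦ N s).1 hs q hq)
  let f : W →ₗ[K] Dual K N := (Φ.compl₁₂ N.toSubmodule.subtype W.toSubmodule.subtype).flip
  have hf : Function.Injective f := by
    rw [injective_iff_map_eq_zero]
    intro r hr
    have hmem : (r : M) ∈ LieAlgebra.InvariantForm.orthogonal Φ hΦ N ⊓ W :=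
      ⟨(LieAlgebra.InvariantForm.mem_orthogonal Φ hΦ N r).2 fun q hq =>
        LinearMap.congr_fun hr ⟨q, hq⟩, r.2⟩
    rw [hperp, LieSubmodule.mem_bot] at hmem
    exact Subtype.ext hmem
  have : FiniteDimensional K N := Submodule.finiteDimensional_of_le (S₂ := W.toSubmodule) hN.le
  have hle : finrank K W ≤ finrank K N :=
    (LinearMap.finrank_le_finrank_of_injective hf).trans_eq Subspace.dual_finrank_eq
  exact LieSubmodule.toSubmodule_injective (Submodule.eq_of_le_of_finrank_le hN.le hle)

end InvariantForm

theorem isIrreducible_of_isAtom {R L M : Type*} [CommRing R] [LieRing L] [AddCommGroup M]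
    [Module R M] [LieRingModule L M] {W : LieSubmodule R L M} (hW : IsAtom W) :
    LieModule.IsIrreducible R L W := by
  have : Nontrivial W := (LieSubmodule.nontrivial_iff_ne_bot R L M).2 hW.1
  refine LieModule.IsIrreducible.mk fun N hN => not_lt_top_iff.1 fun hlt => hN ?_
  have hmap : N.map W.incl = ⊥ := hW.2 _ (LieSubmodule.map_incl_lt_iff_lt_top.2 hlt)
  exact LieSubmodule.map_injective_of_injective W.injective_incl
    (hmap.trans LieSubmodule.map_bot.symm)

/-! ### Duals, graphs and spans in representations -/

section Representations

variable {K L M N : Type*} [Field K] [LieRing L] [AddCommGroup M] [Module K M]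
  [LieRingModule L M] [AddCommGroup N] [Module K N] [LieRingModule L N]

instance prodLieRingModule : LieRingModule L (M × N) where
  bracket X p := (⁅X, p.1⁆, ⁅X, p.2⁆)
  add_lie X Y p := Prod.ext (add_lie X Y p.1) (add_lie X Y p.2)
  lie_add X p q := Prod.ext (lie_add X p.1 q.1) (lie_add X p.2 q.2)
  leibniz_lie X Y p := Prod.ext (leibniz_lie X Y p.1) (leibniz_lie X Y p.2)

theorem prod_lie (X : L) (p : M × N) : ⁅X, p⁆ = (⁅X, p.1⁆, ⁅X, p.2⁆) := rfl

instance prodLieModule [LieAlgebra K L] [LieModule K L M] [LieModule K L N] :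
    LieModule K L (M × N) where
  smul_lie c X p := Prod.ext (smul_lie c X p.1) (smul_lie c X p.2)
  lie_smul c X p := Prod.ext (lie_smul c X p.1) (lie_smul c X p.2)

/-- A bijective homomorphism of Lie modules, as an equivalence. -/
def lieModuleEquivOfBijective (f : M →ₗ⁅K,L⁆ N) (h : Function.Bijective f) : M ≃ₗ⁅K,L⁆ N :=
  { LinearEquiv.ofBijective (f : M →ₗ[K] N) h, f with }

theorem bijective_of_disjoint_ker {G : Type*} [AddCommGroup G] [Module K G] [LieRingModule L G]
    [LieModule.IsIrreducible K L M] [LieModule.IsIrreducible K L N] {p : G →ₗ⁅K,L⁆ M}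
    {q : G →ₗ⁅K,L⁆ N} (hpq : Disjoint p.ker q.ker) {g : G} (hg : p g ≠ 0)
    (hker : ∀ z ∈ p.ker, q z ≠ q g) : Function.Bijective p := by
  constructor
  · rw [← LieModuleHom.ker_eq_bot]
    have hmap : p.ker.map q = ⊥ := (eq_bot_or_eq_top _).resolve_right fun htop => by
      obtain ⟨z, hz, hzg⟩ := (LieSubmodule.mem_map _).1 (htop ▸ LieSubmodule.mem_top (q g))
      exact hker z hz hzg
    exact hpq.eq_bot_of_le ((LieModuleHom.le_ker_iff_map _).2 hmap)
  · rw [← LieModuleHom.range_eq_top]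
    refine (eq_bot_or_eq_top _).resolve_left fun hbot => hg ?_
    rw [← LieSubmodule.mem_bot (R := K) (L := L), ← hbot]
    exact (LieModuleHom.mem_range _ _).2 ⟨g, rfl⟩

theorem nonempty_equiv_of_lieSpan [LieModule.IsIrreducible K L M] [LieModule.IsIrreducible K L N]
    {x : M} {y : N} (hx : x ≠ 0) (hy : y ≠ 0)
    (hfst : (x, (0 : N)) ∉ LieSubmodule.lieSpan K L {(x, y)})
    (hsnd : ((0 : M), y) ∉ LieSubmodule.lieSpan K L {(x, y)}) : Nonempty (M ≃ₗ⁅K,L⁆ N) := by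
  let p : LieSubmodule.lieSpan K L {(x, y)} →ₗ⁅K,L⁆ M :=
    { LinearMap.fst K M N ∘ₗ Submodule.subtype _ with map_lie' := rfl }
  let q : LieSubmodule.lieSpan K L {(x, y)} →ₗ⁅K,L⁆ N :=
    { LinearMap.snd K M N ∘ₗ Submodule.subtype _ with map_lie' := rfl }
  let g : LieSubmodule.lieSpan K L {(x, y)} :=
    ⟨(x, y), LieSubmodule.subset_lieSpan (Set.mem_singleton _)⟩
  have hpq : Disjoint p.ker q.ker := by
    rw [disjoint_iff, LieSubmodule.eq_bot_iff]
    exact fun z ⟨hp, hq⟩ => Subtype.ext (Prod.ext hp hq)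
  have hp : Function.Bijective p := bijective_of_disjoint_ker hpq (g := g) hx fun z hz hzy =>
    hsnd ((Prod.ext hz hzy : (z : M × N) = (0, y)) ▸ z.2)
  have hq : Function.Bijective q := bijective_of_disjoint_ker hpq.symm (g := g) hy fun z hz hzx =>
    hfst ((Prod.ext hzx hz : (z : M × N) = (x, 0)) ▸ z.2)
  exact ⟨(lieModuleEquivOfBijective p hp).symm.trans (lieModuleEquivOfBijective q hq)⟩

/-- The smallest subspace containing `v` and stable under the action of the elements of `A`. -/
def stableSpan (K : Type*) [Field K] [Module K M] (A : Set L) (v : M) : Submodule K M :=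
  sInf {S | v ∈ S ∧ ∀ a ∈ A, ∀ s ∈ S, ⁅a, s⁆ ∈ S}

variable {A : Set L} {v : M}

theorem self_mem_stableSpan : v ∈ stableSpan K A v := Submodule.mem_sInf.2 fun _ hS => hS.1

theorem lie_mem_stableSpan {a : L} (ha : a ∈ A) {s : M} (hs : s ∈ stableSpan K A v) :
    ⁅a, s⁆ ∈ stableSpan K A v :=
  Submodule.mem_sInf.2 fun S hS => hS.2 a ha s (Submodule.mem_sInf.1 hs S hS)

theorem stableSpan_le {S : Submodule K M} (hv : v ∈ S) (hS : ∀ a ∈ A, ∀ s ∈ S, ⁅a, s⁆ ∈ S) :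
    stableSpan K A v ≤ S := sInf_le ⟨hv, hS⟩

variable [LieAlgebra K L] [LieModule K L M] [LieModule K L N]

/-- An isomorphism `N ≃ M*` with the dual of a reflexive Lie module, transposed to `M ≃ N*`. -/
def lieEquivDualFlip [IsReflexive K M] (f : N ≃ₗ⁅K,L⁆ Dual K M) : M ≃ₗ⁅K,L⁆ Dual K N :=
  { f.toLinearEquiv.flip with
    map_lie' {X x} := LinearMap.ext fun y => by
      have h : f ⁅X, y⁆ = ⁅X, f y⁆ := f.toLieModuleHom.map_lie X y
      change f y ⁅X, x⁆ = ⁅X, f.toLinearEquiv.flip x⁆ y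
      rw [Module.Dual.lie_apply]
      change f y ⁅X, x⁆ = -f ⁅X, y⁆ x
      rw [h, Module.Dual.lie_apply, neg_neg] }

theorem dual_isIrreducible [FiniteDimensional K M] (h : LieModule.IsIrreducible K L M) :
    LieModule.IsIrreducible K L (Dual K M) := by
  have : Nontrivial M := LieModule.nontrivial_of_isIrreducible K L M
  refine LieModule.IsIrreducible.mk fun P hP => ?_
  let Q : LieSubmodule K L M :=
    { P.toSubmodule.dualCoannihilator with
      lie_mem {X x} hx := (Submodule.mem_dualCoannihilator _).2 fun f hf => by
        have hXf := (Submodule.mem_dualCoannihilator _).1 hx _ (P.lie_mem (x := X) hf)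
        rwa [Module.Dual.lie_apply, neg_eq_zero] at hXf }
  have hPQ : Q.toSubmodule.dualAnnihilator = P.toSubmodule :=
    Subspace.dualCoannihilator_dualAnnihilator_eq
  rcases eq_bot_or_eq_top Q with hQ | hQ
  · exact LieSubmodule.toSubmodule_injective (by simpa [hQ] using hPQ.symm)
  · exact absurd (LieSubmodule.toSubmodule_injective (by simpa [hQ] using hPQ.symm)) hP

theorem lieSpan_le_stableSpan (h : ∀ X : L, ⁅X, v⁆ ∈ stableSpan K A v) :
    (LieSubmodule.lieSpan K L {v}).toSubmodule ≤ stableSpan K A v := by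
  let T : Submodule K M := ⨅ X : L, (stableSpan K A v).comap (LieModule.toEnd K L M X)
  have mem_T {s : M} : s ∈ T ↔ ∀ X : L, ⁅X, s⁆ ∈ stableSpan K A v := by simp [T]
  have hT : stableSpan K A v ≤ stableSpan K A v ⊓ T := by
    refine stableSpan_le ⟨self_mem_stableSpan, mem_T.2 h⟩ fun a ha s ⟨hs, hsT⟩ =>
      ⟨lie_mem_stableSpan ha hs, mem_T.2 fun X => ?_⟩
    rw [leibniz_lie]
    exact add_mem (mem_T.1 hsT _) (lie_mem_stableSpan ha (mem_T.1 hsT X))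
  let S : LieSubmodule K L M :=
    { stableSpan K A v with lie_mem {X _} hs := mem_T.1 (hT hs).2 X }
  exact LieSubmodule.lieSpan_le (N := S).2 (Set.singleton_subset_iff.2 self_mem_stableSpan)

theorem lie_mem_iSup_eigenspace {h a : L} {n : ℕ} (ha : ⁅h, a⁆ = -((n : K) + 1) • a) {c : K} {s : M}
    (hs : s ∈ ⨆ k : ℕ, (LieModule.toEnd K L M h).eigenspace (c - k)) :
    ⁅a, s⁆ ∈ ⨆ k : ℕ, (LieModule.toEnd K L M h).eigenspace (c - (k + 1)) := by
  induction hs using Submodule.iSup_induction' with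
  | zero => rw [lie_zero]; exact zero_mem _
  | add s t _ _ hs ht => rw [lie_add]; exact add_mem hs ht
  | mem k s hs =>
    refine Submodule.mem_iSup_of_mem (k + n) ?_
    rw [Module.End.mem_eigenspace_iff, LieModule.toEnd_apply_apply] at hs ⊢
    rw [leibniz_lie, ha, hs, smul_lie, lie_smul, ← add_smul]
    congr 1
    push_cast
    ring

theorem mem_span_of_mem_stableSpan [CharZero K] {h : L}
    (hA : ∀ a ∈ A, ∃ n : ℕ, ⁅h, a⁆ = -((n : K) + 1) • a) {c : K} (hv : ⁅h, v⁆ = c • v) {x : M}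
    (hx : x ∈ stableSpan K A v) (hxc : ⁅h, x⁆ = c • x) : x ∈ Submodule.span K {v} := by
  set f := LieModule.toEnd K L M h
  set U : Submodule K M := ⨆ k : ℕ, f.eigenspace (c - (k + 1))
  have hspan : Submodule.span K {v} ≤ f.eigenspace c :=
    (Submodule.span_singleton_le_iff_mem _ _).2 (Module.End.mem_eigenspace_iff.2 hv)
  have hsup : Submodule.span K {v} ⊔ U ≤ ⨆ k : ℕ, f.eigenspace (c - k) :=
    sup_le (hspan.trans (le_iSup_of_le 0 (by simp)))
      (iSup_le fun k => le_iSup_of_le (k + 1) (by simp))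
  have hstable : stableSpan K A v ≤ Submodule.span K {v} ⊔ U := by
    refine stableSpan_le (Submodule.mem_sup_left (Submodule.mem_span_singleton_self v))
      fun a ha s hs => Submodule.mem_sup_right ?_
    obtain ⟨n, hn⟩ := hA a ha
    exact lie_mem_iSup_eigenspace hn (hsup hs)
  have hdisj : Disjoint (f.eigenspace c) U :=
    (f.eigenspaces_iSupIndep c).mono_right (iSup_le fun k => le_iSup₂_of_le (c - (k + 1))
      (fun hk => Nat.cast_add_one_ne_zero (R := K) k (sub_eq_self.1 hk)) le_rfl)
  obtain ⟨y, hy, u, hu, rfl⟩ := Submodule.mem_sup.1 (hstable hx)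
  have huc : u ∈ f.eigenspace c :=
    (Submodule.add_mem_iff_right _ (hspan hy)).1 (Module.End.mem_eigenspace_iff.2 hxc)
  rwa [Submodule.disjoint_def.1 hdisj u huc hu, add_zero]

end Representations

/-! ### Isotropic vectors -/

section QuadraticSpace

variable {K E : Type*} [Field K] [AddCommGroup E] [Module K E] {B D : LinearMap.BilinForm K E}

theorem exists_bilin_apply_eq {ι : Type*} [FiniteDimensional K E] (hB : B.Nondegenerate)
    {v : ι → E} (hv : LinearIndependent K v) (c : ι → K) : ∃ x, ∀ i, B x (v i) = c i := by
  obtain ⟨f, hf⟩ := ((Basis.span hv).constr K c).exists_extend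
  obtain ⟨x, rfl⟩ := (B.toDual hB).surjective f
  refine ⟨x, fun i => ?_⟩
  have h := LinearMap.congr_fun hf (Basis.span hv i)
  rwa [Basis.constr_basis, LinearMap.comp_apply, Submodule.subtype_apply, Basis.span_apply] at h

theorem orthogonal_le_of_isotropic [NeZero (2 : K)] [FiniteDimensional K E] (hsymm : B.IsSymm)
    (hnd : B.Nondegenerate) {S : Submodule K E} (h : ∀ w ∈ B.orthogonal S, B w w = 0) :
    B.orthogonal S ≤ S := by
  intro x hx
  rw [← LinearMap.BilinForm.orthogonal_orthogonal hnd hsymm.isRefl S]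
  intro y hy
  have hxy := h _ (add_mem hx hy)
  rw [map_add, map_add, LinearMap.add_apply, LinearMap.add_apply, h x hx, h y hy, zero_add,
    add_zero, hsymm.eq x y, ← two_mul] at hxy
  exact (mul_eq_zero.1 hxy).resolve_left two_ne_zero

variable [IsAlgClosed K]

theorem exists_smul_self_eq_one {w : E} (h : B w w ≠ 0) : ∃ s : K, B (s • w) (s • w) = 1 := by
  obtain ⟨s, hs⟩ := IsAlgClosed.exists_pow_nat_eq (B w w)⁻¹ (n := 2) two_pos
  refine ⟨s, ?_⟩
  rw [map_smul, LinearMap.map_smul₂, smul_eq_mul, smul_eq_mul, ← mul_assoc, ← pow_two, hs,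
    inv_mul_cancel₀ h]

theorem exists_mem_orthogonal_self_eq_one [NeZero (2 : K)] [FiniteDimensional K E]
    (hsymm : B.IsSymm) (hnd : B.Nondegenerate) {S : Submodule K E} (hS : ¬B.orthogonal S ≤ S) :
    ∃ w ∈ B.orthogonal S, B w w = 1 := by
  obtain ⟨w, hw, hww⟩ : ∃ w ∈ B.orthogonal S, B w w ≠ 0 := by
    by_contra! h
    exact hS (orthogonal_le_of_isotropic hsymm hnd h)
  obtain ⟨s, hs⟩ := exists_smul_self_eq_one hww
  exact ⟨s • w, Submodule.smul_mem _ s hw, hs⟩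

theorem exists_orthonormal_pair [NeZero (2 : K)] [FiniteDimensional K E] (hsymm : B.IsSymm)
    (hnd : B.Nondegenerate) {S : Submodule K E} (hS : 2 * (finrank K S + 1) ≤ finrank K E) :
    ∃ w ∈ B.orthogonal S, ∃ y ∈ B.orthogonal S, B w w = 1 ∧ B y y = 1 ∧ B w y = 0 := by
  obtain ⟨w, hw, hww⟩ := exists_mem_orthogonal_self_eq_one hsymm hnd (S := S) fun h => by
    have := Submodule.finrank_mono h
    rw [LinearMap.BilinForm.finrank_orthogonal hnd] at this
    lia
  have hwT : w ∈ S ⊔ K ∙ w := Submodule.mem_sup_right (Submodule.mem_span_singleton_self w)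
  have hT : finrank K (S ⊔ K ∙ w : Submodule K E) ≤ finrank K S + 1 :=
    (Submodule.finrank_add_le_finrank_add_finrank S (K ∙ w)).trans
      (Nat.add_le_add_left (finrank_span_singleton (ne_of_apply_ne (B w) (by simp [hww]))).le _)
  obtain ⟨y, hy, hyy⟩ := exists_mem_orthogonal_self_eq_one hsymm hnd (S := S ⊔ K ∙ w) fun h => by
    have heq := Submodule.eq_of_le_of_finrank_le h
      (by rw [LinearMap.BilinForm.finrank_orthogonal hnd]; lia)
    have hww' : B w w = 0 := heq.ge hwT w hwT
    exact one_ne_zero (hww.symm.trans hww')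
  exact ⟨w, hw, y, fun s hs => hy s (Submodule.mem_sup_left hs), hww, hyy, hy w hwT⟩

theorem exists_isotropic_mem_orthogonal [NeZero (2 : K)] [FiniteDimensional K E]
    (hsymm : B.IsSymm) (hnd : B.Nondegenerate) {S : Submodule K E}
    (hS : 2 * (finrank K S + 1) ≤ finrank K E) : ∃ z ∈ B.orthogonal S, B z z = 0 ∧ z ∉ S := by
  obtain ⟨w, hw, y, hy, hww, hyy, hwy⟩ := exists_orthonormal_pair hsymm hnd hS
  obtain ⟨i, hi⟩ := IsAlgClosed.exists_pow_nat_eq (-1 : K) (n := 2) two_pos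
  have hyw : B y w = 0 := by rw [hsymm.eq, hwy]
  refine ⟨w + i • y, add_mem hw (Submodule.smul_mem _ i hy), ?_, fun hz => ?_⟩
  · simp only [map_add, LinearMap.add_apply, map_smul, LinearMap.smul_apply, hww, hyy, hwy, hyw,
      smul_eq_mul]
    linear_combination hi
  · have h : B (w + i • y) w = 0 := hw _ hz
    simp [hww, hyw] at h

section Proportionality

variable (hB : B.IsSymm) (hD : D.IsSymm) (h : ∀ x, B x x = 0 → D x x = 0)
include hB hD h

theorem bilin_apply_of_isotropic_of_perp [NeZero (2 : K)] {w x : E} (hww : B w w = 1)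
    (hxw : B x w = 0) : D x x = D w w * B x x ∧ (B x x ≠ 0 → D x w = 0) := by
  obtain ⟨s, hs⟩ := IsAlgClosed.exists_pow_nat_eq (-B x x) (n := 2) two_pos
  have hwx : B w x = 0 := by rw [hB.eq, hxw]
  have hadd := h (x + s • w) (by
    simp only [map_add, LinearMap.add_apply, map_smul, LinearMap.smul_apply, hww, hxw, hwx,
      smul_eq_mul]
    linear_combination hs)
  have hsub := h (x - s • w) (by
    simp only [map_sub, LinearMap.sub_apply, map_smul, LinearMap.smul_apply, hww, hxw, hwx,
      smul_eq_mul]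
    linear_combination hs)
  simp only [map_add, map_sub, LinearMap.add_apply, LinearMap.sub_apply, map_smul,
    LinearMap.smul_apply, hD.eq w x, smul_eq_mul] at hadd hsub
  have h2 : (2 : K) ≠ 0 := two_ne_zero
  refine ⟨mul_left_cancel₀ h2 (by linear_combination hadd + hsub - 2 * D w w * hs), fun hx => ?_⟩
  have hs0 : s ≠ 0 := by
    rintro rfl
    exact hx (by linear_combination hs)
  exact mul_left_cancel₀ (mul_ne_zero (mul_ne_zero h2 h2) hs0) (by linear_combination hadd - hsub)

theorem bilin_apply_eq_zero_of_isotropic_of_perp [NeZero (2 : K)] {w y x : E} (hww : B w w = 1)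
    (hyy : B y y = 1) (hyw : B y w = 0) (hxw : B x w = 0) : D x w = 0 := by
  by_cases hx : B x x = 0
  · have hD_yw := (bilin_apply_of_isotropic_of_perp hB hD h hww hyw).2 (hyy ▸ one_ne_zero)
    have hadd := (bilin_apply_of_isotropic_of_perp hB hD h hww (x := x + y) (by simp [hxw, hyw])).2
    have hsub := (bilin_apply_of_isotropic_of_perp hB hD h hww (x := x - y) (by simp [hxw, hyw])).2
    simp only [map_add, map_sub, LinearMap.add_apply, LinearMap.sub_apply, hx, hyy, hB.eq y x,
      hD_yw, add_zero, sub_zero] at hadd hsub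
    by_cases hxy : 0 + B x y + (B x y + 1) = 0
    · refine hsub fun hxy' => two_ne_zero (α := K) ?_
      linear_combination hxy + hxy'
    · exact hadd hxy
  · exact (bilin_apply_of_isotropic_of_perp hB hD h hww hxw).2 hx

theorem eq_smul_of_isotropic [NeZero (2 : K)] {w y : E} (hww : B w w = 1) (hyy : B y y = 1)
    (hyw : B y w = 0) : D = D w w • B := by
  refine LinearMap.BilinForm.ext_of_isSymm hD (hB.smul _) fun x => ?_
  have hxw : B (x - B x w • w) w = 0 := by simp [hww]
  have hdiag := (bilin_apply_of_isotropic_of_perp hB hD h hww hxw).1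
  have hmix := bilin_apply_eq_zero_of_isotropic_of_perp hB hD h hww hyy hyw hxw
  simp only [map_sub, map_smul, LinearMap.sub_apply, LinearMap.smul_apply, smul_eq_mul,
    hD.eq w x, hB.eq w x, hww] at hdiag hmix ⊢
  linear_combination hdiag + 2 * B x w * hmix

end Proportionality

theorem exists_eq_mul_on_orthogonal [NeZero (2 : K)] [FiniteDimensional K E] (hB : B.IsSymm)
    (hnd : B.Nondegenerate) (hD : D.IsSymm) {S : Submodule K E}
    (hS : 2 * (finrank K S + 1) ≤ finrank K E)
    (h : ∀ x ∈ B.orthogonal S, B x x = 0 → D x x = 0) :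
    ∃ c, ∀ x ∈ B.orthogonal S, ∀ y ∈ B.orthogonal S, D x y = c * B x y := by
  obtain ⟨w, hw, y, hy, hww, hyy, hwy⟩ := exists_orthonormal_pair hB hnd hS
  have hDB := eq_smul_of_isotropic (B := B.restrict (B.orthogonal S))
    (D := D.restrict (B.orthogonal S)) ⟨fun x y => hB.eq x y⟩ ⟨fun x y => hD.eq x y⟩
    (fun x => h x x.2) (w := ⟨w, hw⟩) (y := ⟨y, hy⟩) hww hyy ((hB.eq y w).trans hwy)
  exact ⟨D w w, fun x hx y hy => LinearMap.congr_fun₂ hDB ⟨x, hx⟩ ⟨y, hy⟩⟩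

end QuadraticSpace

variable {m : ℕ}

/-! ### Bivectors -/

theorem so_skew (X : so m) (v w : V m) : form m (X.1 v) w = -form m v (X.1 w) :=
  (mem_so_iff X.1).1 X.2 v w

/-- The bivector `v ∧ w`, regarded as an element of `so_{2m}`. -/
def bv (m : ℕ) : V m →ₗ[ℂ] V m →ₗ[ℂ] so m :=
  (wedgeₗ m).compr₂ (bivectorEquiv m).toLinearMap

theorem bv_apply (v w u : V m) : (bv m v w).1 u = form m v u • w - form m w u • v :=
  bivectorEquiv_wedge v w u

theorem bv_swap (v w : V m) : bv m v w = -bv m w v := by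
  change bivectorEquiv m (wedge v w) = -bivectorEquiv m (wedge w v)
  rw [wedge_swap, map_neg]

@[simp]
theorem bv_self (v : V m) : bv m v v = 0 :=
  Subtype.ext (LinearMap.ext fun u => (bv_apply v v u).trans (sub_self _))

theorem lie_bv (X : so m) (v w : V m) : ⁅X, bv m v w⁆ = bv m (X.1 v) w + bv m v (X.1 w) :=
  lie_bivectorEquiv_wedge X v w

theorem so_linearMap_ext {N : Type*} [AddCommGroup N] [Module ℂ N] {f g : so m →ₗ[ℂ] N}
    (h : ∀ v w, f (bv m v w) = g (bv m v w)) : f = g :=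
  (LinearEquiv.eq_comp_toLinearMap_iff (e₁₂ := bivectorEquiv m) f g).mp (wedge_ext h)

theorem span_bv_e : Submodule.span ℂ (Set.range fun p : Fin (2 * m) × Fin (2 * m) =>
    bv m (e p.1) (e p.2)) = ⊤ := by
  set S := Submodule.span ℂ (Set.range fun p : Fin (2 * m) × Fin (2 * m) => bv m (e p.1) (e p.2))
  have hS : (bv m).compr₂ S.mkQ = 0 := by
    refine LinearMap.pi_ext' fun i => LinearMap.ext_ring (LinearMap.pi_ext' fun j =>
      LinearMap.ext_ring ?_)
    exact (Submodule.Quotient.mk_eq_zero S).mpr (Submodule.subset_span ⟨(i, j), rfl⟩)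
  have hmkQ : S.mkQ = 0 := so_linearMap_ext fun v w => LinearMap.congr_fun₂ hS v w
  rw [← S.ker_mkQ, hmkQ, LinearMap.ker_zero]

/-! ### Curvature components and their contractions -/

/-- The components of the symmetric bilinear form of `q` on decomposable bivectors; they have the
symmetries of a curvature tensor except for the Bianchi identity. -/
def curv (q : QuadraticForm ℂ (so m)) (u v x y : V m) : ℂ :=
  QuadraticMap.associated q (bv m u v) (bv m x y)

section CurvatureSymmetries

variable (q : QuadraticForm ℂ (so m)) (u v x y : V m)

theorem curv_symm : curv q u v x y = curv q x y u v :=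
  QuadraticMap.associated_isSymm ℂ q _ _

theorem curv_swap_left : curv q u v x y = -curv q v u x y := by
  simp only [curv, bv_swap u v, map_neg, LinearMap.neg_apply]

theorem curv_swap_right : curv q u v x y = -curv q u v y x := by
  simp only [curv, bv_swap x y, map_neg]

theorem curv_self : curv q u v u v = q (bv m u v) :=
  QuadraticMap.associated_eq_self_apply ℂ q _

theorem curv_lie (X : so m) :
    curv ⁅X, q⁆ u v x y = -(curv q (X.1 u) v x y + curv q u (X.1 v) x y +
      curv q u v (X.1 x) y + curv q u v x (X.1 y)) := by
  simp only [curv, associated_lie, lie_bv, map_add, LinearMap.add_apply]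
  ring

end CurvatureSymmetries

theorem curv_ext {q r : QuadraticForm ℂ (so m)}
    (h : ∀ u v x y, curv q u v x y = curv r u v x y) : q = r := by
  apply QuadraticMap.associated_rightInverse ℂ |>.injective
  exact so_linearMap_ext fun u v => so_linearMap_ext fun x y => h u v x y

/-- The trace of a bilinear form on `ℂ^{2m}` with respect to the standard form. -/
def btrace (m : ℕ) : LinearMap.BilinForm ℂ (V m) →ₗ[ℂ] ℂ where
  toFun B := ∑ k : Fin (2 * m), B (e k) (e k.rev)
  map_add' B C := by simp [Finset.sum_add_distrib]
  map_smul' c B := by simp [Finset.mul_sum]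

theorem btrace_apply (B : LinearMap.BilinForm ℂ (V m)) :
    btrace m B = ∑ k : Fin (2 * m), B (e k) (e k.rev) := rfl

theorem btrace_flip (B : LinearMap.BilinForm ℂ (V m)) :
    btrace m (LinearMap.flip B) = btrace m B := by
  rw [btrace_apply, ← Equiv.sum_comp Fin.revPerm]
  simp [btrace_apply]

theorem sum_form_mul (f : Dual ℂ (V m)) (v : V m) :
    ∑ k : Fin (2 * m), form m v (e k) * f (e k.rev) = f v := by
  conv_rhs => rw [← sum_form_smul v]
  simp only [map_sum, map_smul, smul_eq_mul]

theorem sum_mul_form (f : Dual ℂ (V m)) (v : V m) :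
    ∑ k : Fin (2 * m), f (e k) * form m v (e k.rev) = f v := by
  rw [← sum_form_mul, ← Equiv.sum_comp Fin.revPerm]
  simp [mul_comm]

theorem btrace_comp_add_compRight (B : LinearMap.BilinForm ℂ (V m)) (X : so m) :
    btrace m (B.compLeft X.1) + btrace m (B.compRight X.1) = 0 := by
  have expand (f : Dual ℂ (V m)) (k : Fin (2 * m)) :
      f (X.1 (e k)) = ∑ j : Fin (2 * m), form m (X.1 (e k)) (e j) * f (e j.rev) :=
    (sum_form_mul f _).symm
  have hleft : btrace m (B.compLeft X.1) = ∑ k : Fin (2 * m), ∑ j : Fin (2 * m),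
      form m (X.1 (e k)) (e j) * B (e j.rev) (e k.rev) := by
    rw [btrace_apply]
    exact Finset.sum_congr rfl fun k _ => expand (B.flip (e k.rev)) k
  have hright : btrace m (B.compRight X.1) = ∑ k : Fin (2 * m), ∑ j : Fin (2 * m),
      form m (X.1 (e k)) (e j) * B (e k.rev) (e j.rev) := by
    rw [← btrace_flip, btrace_apply]
    refine Finset.sum_congr rfl fun k _ => expand (B (e k.rev)) k
  rw [hleft, hright, Finset.sum_comm, ← Finset.sum_add_distrib]
  refine Finset.sum_eq_zero fun k _ => ?_
  rw [← Finset.sum_add_distrib]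
  refine Finset.sum_eq_zero fun j _ => ?_
  rw [so_skew, form_comm, neg_mul, neg_add_cancel]

/-- The Ricci contraction. -/
def ric (m : ℕ) : QuadraticForm ℂ (so m) →ₗ[ℂ] LinearMap.BilinForm ℂ (V m) where
  toFun q := LinearMap.mk₂ ℂ
    (fun x y => btrace m ((QuadraticMap.associated q).compl₁₂ (bv m x) (bv m y)))
    (by intros; simp [btrace_apply, Finset.sum_add_distrib])
    (by intros; simp [btrace_apply, Finset.mul_sum])
    (by intros; simp [btrace_apply, Finset.sum_add_distrib])
    (by intros; simp [btrace_apply, Finset.mul_sum])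
  map_add' _ _ := by ext; simp [btrace_apply, Finset.sum_add_distrib]
  map_smul' _ _ := by ext; simp [btrace_apply, Finset.mul_sum]

theorem ric_apply (q : QuadraticForm ℂ (so m)) (x y : V m) :
    ric m q x y = ∑ k : Fin (2 * m), curv q x (e k) y (e k.rev) := rfl

theorem ric_comm (q : QuadraticForm ℂ (so m)) (x y : V m) : ric m q x y = ric m q y x := by
  rw [ric_apply, ric_apply, ← Equiv.sum_comp Fin.revPerm]
  simp [curv_symm q x]

theorem ric_lie (X : so m) (q : QuadraticForm ℂ (so m)) (x y : V m) :
    ric m ⁅X, q⁆ x y = -(ric m q (X.1 x) y + ric m q x (X.1 y)) := by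
  have h := btrace_comp_add_compRight
    ((QuadraticMap.associated q).compl₁₂ (bv m x) (bv m y)) X
  simp only [btrace_apply, LinearMap.BilinForm.compLeft_apply,
    LinearMap.BilinForm.compRight_apply, LinearMap.compl₁₂_apply] at h
  simp only [ric_apply, curv_lie, Finset.sum_neg_distrib, Finset.sum_add_distrib]
  simp only [curv]
  linear_combination -h

theorem curv_self_left (q : QuadraticForm ℂ (so m)) (u x y : V m) : curv q u u x y = 0 := by
  simp only [curv, bv_self, map_zero, LinearMap.zero_apply]

theorem curv_self_right (q : QuadraticForm ℂ (so m)) (u v x : V m) : curv q u v x x = 0 := by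
  simp only [curv, bv_self, map_zero]

/-- The cyclic sum of curvature components which the Bianchi identity equates to zero. -/
def bianchiSum (q : QuadraticForm ℂ (so m)) (u v x y : V m) : ℂ :=
  curv q u v x y + curv q v x u y + curv q x u v y

theorem bianchiSum_rotate (q : QuadraticForm ℂ (so m)) (u v x y : V m) :
    bianchiSum q u v x y = bianchiSum q v x u y := by
  unfold bianchiSum
  ring

theorem bianchiSum_self_left (q : QuadraticForm ℂ (so m)) (u x y : V m) :
    bianchiSum q u u x y = 0 := by
  rw [bianchiSum, curv_self_left, curv_swap_left q x u, zero_add, add_neg_cancel]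

theorem bianchiSum_self_right (q : QuadraticForm ℂ (so m)) (u v x : V m) :
    bianchiSum q u v x x = 0 := by
  rw [bianchiSum, curv_self_right, curv_symm q v x, curv_swap_left q x u, zero_add,
    add_neg_cancel]

/-- The Bianchi sum as an alternating form, depending linearly on the quadratic form. -/
def bianchi (m : ℕ) : QuadraticForm ℂ (so m) →ₗ[ℂ] V m [⋀^Fin 4]→ₗ[ℂ] ℂ where
  toFun q :=
    { MultilinearMap.mk' (fun a : Fin 4 → V m => bianchiSum q (a 0) (a 1) (a 2) (a 3))
        (by
          intro a i x y
          fin_cases i <;> simp [bianchiSum, curv, Function.update] <;> ring)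
        (by
          intro a i c x
          fin_cases i <;> simp [bianchiSum, curv, Function.update] <;> ring) with
      map_eq_zero_of_eq' := by
        intro a i j hij hne
        change bianchiSum q (a 0) (a 1) (a 2) (a 3) = 0
        wlog hlt : i < j generalizing i j
        · exact this j i hij.symm hne.symm (lt_of_le_of_ne (not_lt.mp hlt) hne.symm)
        fin_cases i <;> fin_cases j <;> try exact absurd hlt (by decide)
        · rw [show a 0 = a 1 from hij, bianchiSum_self_left]
        · rw [show a 0 = a 2 from hij, bianchiSum_rotate, bianchiSum_rotate, bianchiSum_self_left]
        · rw [show a 0 = a 3 from hij, bianchiSum_rotate, bianchiSum_self_right]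
        · rw [show a 1 = a 2 from hij, bianchiSum_rotate, bianchiSum_self_left]
        · rw [show a 1 = a 3 from hij, bianchiSum_rotate, bianchiSum_rotate, bianchiSum_self_right]
        · rw [show a 2 = a 3 from hij, bianchiSum_self_right] }
  map_add' q r := by
    ext a
    simp [bianchiSum, curv]
    ring
  map_smul' c q := by
    ext a
    simp [bianchiSum, curv]
    ring

theorem bianchi_apply (q : QuadraticForm ℂ (so m)) (u v x y : V m) :
    bianchi m q ![u, v, x, y] = bianchiSum q u v x y := rfl

theorem bianchiSum_lie (X : so m) (q : QuadraticForm ℂ (so m)) (u v x y : V m) :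
    bianchiSum ⁅X, q⁆ u v x y = -(bianchiSum q (X.1 u) v x y + bianchiSum q u (X.1 v) x y +
      bianchiSum q u v (X.1 x) y + bianchiSum q u v x (X.1 y)) := by
  simp only [bianchiSum, curv_lie]
  ring

theorem mem_ker_bianchi {q : QuadraticForm ℂ (so m)} :
    q ∈ LinearMap.ker (bianchi m) ↔ ∀ u v x y, bianchiSum q u v x y = 0 :=
  ⟨fun h u v x y => DFunLike.congr_fun (LinearMap.mem_ker.mp h) ![u, v, x, y],
    fun h => AlternatingMap.ext fun _ => h _ _ _ _⟩

/-- The quadratic forms of Weyl type: those satisfying the Bianchi identity with vanishing Ricci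
contraction. -/
def weyl (m : ℕ) : LieSubmodule ℂ (so m) (QuadraticForm ℂ (so m)) where
  toSubmodule := LinearMap.ker (bianchi m) ⊓ LinearMap.ker (ric m)
  lie_mem := by
    rintro X q ⟨hbianchi, hric⟩
    refine ⟨mem_ker_bianchi.mpr fun u v x y => ?_, LinearMap.ext₂ fun x y => ?_⟩
    · simp only [bianchiSum_lie, mem_ker_bianchi.mp hbianchi, add_zero, neg_zero]
    · simp [ric_lie, LinearMap.mem_ker.mp hric]

/-! ### Decomposable part -/

theorem associated_transport (q : QuadraticForm ℂ (⋀[ℂ]^2 (V m))) (X Y : so m) :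
    QuadraticMap.associated (transport m q) X Y =
      QuadraticMap.associated q ((bivectorEquiv m).symm X) ((bivectorEquiv m).symm Y) :=
  LinearMap.congr_fun₂ (QuadraticMap.associated_comp ℂ q _) X Y

theorem curv_transport (q : QuadraticForm ℂ (⋀[ℂ]^2 (V m))) (u v x y : V m) :
    curv (transport m q) u v x y = QuadraticMap.associated q (wedge u v) (wedge x y) := by
  change QuadraticMap.associated _ (bivectorEquiv m (wedge u v)) (bivectorEquiv m (wedge x y)) = _
  rw [associated_transport, LinearEquiv.symm_apply_apply, LinearEquiv.symm_apply_apply]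

theorem wedge₂₂_wedge (u v x y : V m) :
    wedge₂₂ m (wedge u v) (wedge x y) = exteriorPower.ιMulti ℂ 4 ![u, v, x, y] := by
  apply Subtype.ext
  change (wedge u v : ExteriorAlgebra ℂ (V m)) * (wedge x y : ExteriorAlgebra ℂ (V m)) = _
  rw [coe_wedge, coe_wedge]
  simp [ExteriorAlgebra.ιMulti_apply, mul_assoc]

theorem ιMulti_four_swap_pairs (u v x y : V m) :
    exteriorPower.ιMulti ℂ 4 ![x, y, u, v] = exteriorPower.ιMulti ℂ 4 ![u, v, x, y] := by
  have hperm : (![x, y, u, v] : Fin 4 → V m) =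
      ![u, v, x, y] ∘ (Equiv.swap 0 2 * Equiv.swap 1 3 : Equiv.Perm (Fin 4)) := by
    ext i : 1
    fin_cases i <;> rfl
  have hsign : Equiv.Perm.sign (Equiv.swap 0 2 * Equiv.swap 1 3 : Equiv.Perm (Fin 4)) = 1 := by
    decide
  rw [hperm, AlternatingMap.map_perm, hsign, one_smul]

theorem curv_transport_Phi (φ : Dual ℂ (⋀[ℂ]^4 (V m))) (u v x y : V m) :
    curv (transport m (Phi m φ)) u v x y = φ (exteriorPower.ιMulti ℂ 4 ![u, v, x, y]) := by
  have hPhi : Phi m φ = LinearMap.BilinMap.toQuadraticMap ((wedge₂₂ m).compr₂ φ) := rfl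
  refine mul_left_cancel₀ (two_ne_zero (α := ℂ)) ?_
  rw [curv_transport, two_mul_associated, hPhi, LinearMap.BilinMap.polar_toQuadraticMap]
  simp only [LinearMap.compr₂_apply, wedge₂₂_wedge, ιMulti_four_swap_pairs u v x y, two_mul]

theorem Phi_injective : Function.Injective (Phi m) := by
  rw [injective_iff_map_eq_zero]
  intro φ hφ
  refine exteriorPower.linearMap_ext (AlternatingMap.ext fun a => ?_)
  have ha : a = ![a 0, a 1, a 2, a 3] := by
    ext i : 1
    fin_cases i <;> rfl
  have hcurv := curv_transport_Phi φ (a 0) (a 1) (a 2) (a 3)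
  rw [hφ, ← ha] at hcurv
  simpa [curv] using hcurv.symm

/-- The element of `V_dec` with the same Bianchi sum as `q`. -/
def decPart (q : QuadraticForm ℂ (so m)) : QuadraticForm ℂ (so m) :=
  transport m (Phi m ((3⁻¹ : ℂ) • exteriorPower.alternatingMapLinearEquiv (bianchi m q)))

theorem decPart_mem (q : QuadraticForm ℂ (so m)) : decPart q ∈ Vdec m :=
  Submodule.mem_map_of_mem (LinearMap.mem_range_self _ _)

theorem curv_decPart (q : QuadraticForm ℂ (so m)) (u v x y : V m) :
    curv (decPart q) u v x y = 3⁻¹ * bianchiSum q u v x y := by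
  rw [decPart, curv_transport_Phi, LinearMap.smul_apply,
    exteriorPower.alternatingMapLinearEquiv_apply_ιMulti, bianchi_apply, smul_eq_mul]

theorem bianchi_decPart (q : QuadraticForm ℂ (so m)) :
    bianchi m (decPart q) = bianchi m q := by
  refine AlternatingMap.ext fun a => ?_
  change bianchiSum (decPart q) (a 0) (a 1) (a 2) (a 3) = bianchiSum q (a 0) (a 1) (a 2) (a 3)
  rw [bianchiSum, curv_decPart, curv_decPart, curv_decPart, bianchiSum_rotate q (a 2),
    bianchiSum_rotate q (a 0)]
  ring

section VanishingOnDecomposables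

variable {q : QuadraticForm ℂ (so m)}

theorem curv_eq_zero_of_vanishing (h : ∀ u v, q (bv m u v) = 0) (u v y : V m) :
    curv q u v u y = 0 := by
  have hsum : curv q u (v + y) u (v + y) = 0 := (curv_self q _ _).trans (h _ _)
  have hv : curv q u v u v = 0 := (curv_self q _ _).trans (h _ _)
  have hy : curv q u y u y = 0 := (curv_self q _ _).trans (h _ _)
  have hsymm := curv_symm q u v u y
  simp only [curv, map_add, LinearMap.add_apply] at hsum hv hy hsymm ⊢
  linear_combination (hsum - hv - hy + hsymm) / 2

theorem curv_swap_outer_of_vanishing (h : ∀ u v, q (bv m u v) = 0) (u v x y : V m) :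
    curv q u v x y = -curv q x v u y := by
  have hsum := curv_eq_zero_of_vanishing h (u + x) v y
  have hu := curv_eq_zero_of_vanishing h u v y
  have hx := curv_eq_zero_of_vanishing h x v y
  simp only [curv, map_add, LinearMap.add_apply] at hsum hu hx ⊢
  linear_combination hsum - hu - hx

theorem bianchiSum_of_vanishing (h : ∀ u v, q (bv m u v) = 0) (u v x y : V m) :
    bianchiSum q u v x y = 3 * curv q u v x y := by
  rw [bianchiSum, curv_swap_left q v x, curv_swap_outer_of_vanishing h x v,
    curv_swap_outer_of_vanishing h x u, curv_swap_left q v u]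
  ring

theorem mem_Vdec : q ∈ Vdec m ↔ ∀ u v, q (bv m u v) = 0 := by
  constructor
  · rintro ⟨_, ⟨φ, rfl⟩, rfl⟩ u v
    rw [← curv_self, curv_transport_Phi, (exteriorPower.ιMulti ℂ 4).map_eq_zero_of_eq
      ![u, v, u, v] (i := 0) (j := 2) rfl (by decide), map_zero]
  · intro h
    have hq : q = decPart q := by
      refine curv_ext fun u v x y => ?_
      rw [curv_decPart, bianchiSum_of_vanishing h, inv_mul_cancel_left₀ three_ne_zero]
    rw [hq]
    exact decPart_mem q

theorem ric_eq_zero_of_mem_Vdec (h : q ∈ Vdec m) : ric m q = 0 := by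
  refine LinearMap.ext₂ fun x y => ?_
  have hanti : ric m q x y = -ric m q y x := by
    rw [ric_apply, ric_apply, ← Finset.sum_neg_distrib]
    exact Finset.sum_congr rfl fun k _ => curv_swap_outer_of_vanishing (mem_Vdec.mp h) _ _ _ _
  rw [ric_comm] at hanti
  rw [ric_comm, LinearMap.zero_apply, LinearMap.zero_apply]
  exact self_eq_neg.mp hanti

theorem lie_mem_Vdec (X : so m) (h : q ∈ Vdec m) : ⁅X, q⁆ ∈ Vdec m := by
  rw [mem_Vdec] at h ⊢
  intro u v
  rw [← curv_self, curv_lie, curv_symm q (X.1 u), curv_symm q u (X.1 v),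
    curv_swap_left q u v (X.1 u), curv_swap_right q v u (X.1 u)]
  simp only [curv_eq_zero_of_vanishing h, add_zero, neg_zero]

end VanishingOnDecomposables

/-! ### Isotropic part -/

theorem bilinForm_eq_sum_smulRight (h : LinearMap.BilinForm ℂ (V m)) :
    h = ∑ i : Fin (2 * m), (LinearMap.proj i : Dual ℂ (V m)).smulRight (h (e i)) := by
  refine LinearMap.pi_ext' fun i => LinearMap.ext_ring ?_
  simp [Pi.single_apply]

theorem bilinForm_linearMap_ext {N : Type*} [AddCommGroup N] [Module ℂ N]
    {F G : LinearMap.BilinForm ℂ (V m) →ₗ[ℂ] N}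
    (hFG : ∀ f g : Dual ℂ (V m), F (f.smulRight g) = G (f.smulRight g)) : F = G := by
  ext1 h
  rw [bilinForm_eq_sum_smulRight h, map_sum, map_sum]
  exact Finset.sum_congr rfl fun i _ => hFG _ _

/-- The product `(f, g) ↦ f · g` of covectors in the symmetric square. -/
def symMul (m : ℕ) : Dual ℂ (V m) →ₗ[ℂ] Dual ℂ (V m) →ₗ[ℂ] Sym[ℂ]^2 (Dual ℂ (V m)) :=
  (MultilinearMap.ofSubsingletonₗ ℂ ℂ _ _ (0 : Fin 1)).symm.toLinearMap ∘ₗ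
    (SymmetricPower.tprod ℂ).curryLeft

theorem symMul_apply (f g : Dual ℂ (V m)) : symMul m f g = SymmetricPower.tprod ℂ ![f, g] := by
  refine congrArg (SymmetricPower.tprod ℂ) (funext fun i => ?_)
  fin_cases i <;> rfl

theorem symMul_comm (f g : Dual ℂ (V m)) : symMul m f g = symMul m g f := by
  rw [symMul_apply, symMul_apply, ← SymmetricPower.tprod_equiv (Equiv.swap (0 : Fin 2) 1) ![f, g]]
  congr 1
  ext i : 1
  fin_cases i <;> rfl

/-- The symmetrization `f ⊗ g ↦ f · g` of bilinear forms. -/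
def symTensor (m : ℕ) : LinearMap.BilinForm ℂ (V m) →ₗ[ℂ] Sym[ℂ]^2 (Dual ℂ (V m)) where
  toFun h := ∑ i : Fin (2 * m), symMul m (LinearMap.proj i) (h (e i))
  map_add' h k := by simp [Finset.sum_add_distrib]
  map_smul' c h := by simp [Finset.smul_sum]

theorem symTensor_smulRight (f g : Dual ℂ (V m)) :
    symTensor m (f.smulRight g) = symMul m f g := by
  have hf : f = ∑ i : Fin (2 * m), f (e i) • (LinearMap.proj i : Dual ℂ (V m)) := by
    refine LinearMap.pi_ext' fun i => LinearMap.ext_ring ?_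
    simp [Pi.single_apply]
  conv_rhs => rw [hf, map_sum, LinearMap.sum_apply]
  simp only [symTensor, LinearMap.coe_mk, AddHom.coe_mk, LinearMap.smulRight_apply, map_smul,
    LinearMap.smul_apply]

theorem symTensor_surjective : Function.Surjective (symTensor m) := by
  rw [← LinearMap.range_eq_top, eq_top_iff, ← SymmetricPower.span_tprod_eq_top,
    Submodule.span_le]
  rintro _ ⟨a, rfl⟩
  have ha : a = ![a 0, a 1] := by
    ext i : 1
    fin_cases i <;> rfl
  exact ⟨(a 0).smulRight (a 1), by rw [symTensor_smulRight, symMul_apply, ← ha]⟩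

theorem symTensor_flip (h : LinearMap.BilinForm ℂ (V m)) :
    symTensor m (LinearMap.flip h) = symTensor m h := by
  have hcomp : symTensor m ∘ₗ LinearMap.lflip.toLinearMap = symTensor m := by
    refine bilinForm_linearMap_ext fun f g => ?_
    have hflip : LinearMap.flip (f.smulRight g) = g.smulRight f := by
      ext
      simp [mul_comm]
    change symTensor m (LinearMap.flip (f.smulRight g)) = _
    rw [hflip, symTensor_smulRight, symTensor_smulRight, symMul_comm]
  exact LinearMap.congr_fun hcomp h

/-- The bilinear form `(X, Y) ↦ tr h(X ·, Y ·)` on `so_{2m}`. -/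
def isoBilin (m : ℕ) : LinearMap.BilinForm ℂ (V m) →ₗ[ℂ] LinearMap.BilinForm ℂ (so m) where
  toFun h := LinearMap.mk₂ ℂ (fun X Y => btrace m (h.compl₁₂ X.1 Y.1))
    (by intros; simp [btrace_apply, Finset.sum_add_distrib])
    (by intros; simp [btrace_apply, Finset.mul_sum])
    (by intros; simp [btrace_apply, Finset.sum_add_distrib])
    (by intros; simp [btrace_apply, Finset.mul_sum])
  map_add' _ _ := LinearMap.ext₂ fun _ _ => by simp [btrace_apply, Finset.sum_add_distrib]
  map_smul' _ _ := LinearMap.ext₂ fun _ _ => by simp [btrace_apply, Finset.mul_sum]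

/-- The quadratic form `X ↦ tr h(X ·, X ·)`, which is `Ψ(f · g)` for `h = f ⊗ g`. -/
def isoForm (m : ℕ) : LinearMap.BilinForm ℂ (V m) →ₗ[ℂ] QuadraticForm ℂ (so m) :=
  LinearMap.BilinMap.toQuadraticMapLinearMap ℂ ℂ (so m) ∘ₗ isoBilin m

theorem contract_form (X : so m) (a : V m) :
    contract m (form m a) ((bivectorEquiv m).symm X) = X.1 a := by
  have hX : bivectorEnd m ((bivectorEquiv m).symm X) = X.1 :=
    congrArg Subtype.val ((bivectorEquiv m).apply_symm_apply X)
  have ha : (form m).flip a = form m a := LinearMap.ext fun v => form_comm v a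
  rw [← hX, ← ha]
  rfl

theorem exists_eq_form (f : Dual ℂ (V m)) : ∃ a, f = form m a := by
  refine ⟨∑ i : Fin (2 * m), f (e i) • e i.rev, LinearMap.pi_ext' fun j => LinearMap.ext_ring ?_⟩
  simp [form_e_e]

theorem transport_Psi_symTensor (h : LinearMap.BilinForm ℂ (V m)) :
    transport m (Psi m (symTensor m h)) = isoForm m h := by
  have hcomp : transport m ∘ₗ Psi m ∘ₗ symTensor m = isoForm m := by
    refine bilinForm_linearMap_ext fun f g => QuadraticMap.ext fun X => ?_
    obtain ⟨a, rfl⟩ := exists_eq_form f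
    obtain ⟨b, rfl⟩ := exists_eq_form g
    rw [LinearMap.comp_apply, LinearMap.comp_apply, symTensor_smulRight, symMul_apply]
    calc Psi m (SymmetricPower.tprod ℂ ![form m a, form m b]) ((bivectorEquiv m).symm X)
      _ = form m (X.1 a) (X.1 b) := by rw [Psi_apply, contract_form, contract_form]
      _ = ∑ k : Fin (2 * m), form m (X.1 a) (e k) * form m (X.1 b) (e k.rev) := by
        rw [sum_form_mul, form_comm]
      _ = ∑ k : Fin (2 * m), form m a (X.1 (e k)) * form m b (X.1 (e k.rev)) := by
        simp only [so_skew, neg_mul_neg]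
  exact LinearMap.congr_fun hcomp h

theorem isoForm_flip (h : LinearMap.BilinForm ℂ (V m)) :
    isoForm m (LinearMap.flip h) = isoForm m h := by
  rw [← transport_Psi_symTensor, symTensor_flip, transport_Psi_symTensor]

theorem mem_Viso {q : QuadraticForm ℂ (so m)} :
    q ∈ Viso m ↔ ∃ h : LinearMap.BilinForm ℂ (V m), (∀ x y, h x y = h y x) ∧ isoForm m h = q := by
  constructor
  · rintro ⟨_, ⟨t, rfl⟩, rfl⟩
    obtain ⟨h, rfl⟩ := symTensor_surjective t
    refine ⟨(2⁻¹ : ℂ) • (h + LinearMap.flip h), fun x y => ?_, ?_⟩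
    · simp [add_comm]
    · rw [map_smul, map_add, isoForm_flip, ← two_smul ℂ, inv_smul_smul₀ two_ne_zero,
        transport_Psi_symTensor]
  · rintro ⟨h, -, rfl⟩
    exact ⟨_, ⟨symTensor m h, rfl⟩, transport_Psi_symTensor h⟩

theorem btrace_form : btrace m (form m) = 2 * m := by
  simp [btrace_apply, form_e_e]

section SymmetricBilinearForm

variable {h : LinearMap.BilinForm ℂ (V m)} (hsymm : ∀ x y, h x y = h y x)
include hsymm

theorem curv_isoForm (u v x y : V m) :
    curv (isoForm m h) u v x y =
      h u x * form m v y - h u y * form m v x - h v x * form m u y + h v y * form m u x := by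
  have hB (X Y : so m) : isoBilin m h X Y = isoBilin m h Y X := by
    have hflip : (h.compl₁₂ Y.1 X.1).flip = h.compl₁₂ X.1 Y.1 :=
      LinearMap.ext₂ fun _ _ => hsymm _ _
    exact (congrArg (btrace m) hflip.symm).trans (btrace_flip _)
  have expand (a b p r : V m) :
      ∑ k : Fin (2 * m), form m a (e k) * form m b (e k.rev) * h p r = form m a b * h p r := by
    rw [← Finset.sum_mul, sum_form_mul, form_comm]
  calc curv (isoForm m h) u v x y
    _ = isoBilin m h (bv m u v) (bv m x y) :=
      LinearMap.congr_fun₂ (QuadraticMap.associated_left_inverse ℂ hB) _ _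
    _ = ∑ k : Fin (2 * m), (form m u (e k) * form m x (e k.rev) * h v y -
        form m u (e k) * form m y (e k.rev) * h v x - form m v (e k) * form m x (e k.rev) * h u y +
        form m v (e k) * form m y (e k.rev) * h u x) := by
      change btrace m _ = _
      rw [btrace_apply]
      refine Finset.sum_congr rfl fun k _ => ?_
      simp only [LinearMap.compl₁₂_apply, bv_apply, map_sub, map_smul, LinearMap.sub_apply,
        LinearMap.smul_apply, smul_eq_mul]
      ring
    _ = _ := by
      simp only [Finset.sum_add_distrib, Finset.sum_sub_distrib, expand]
      ring

theorem ric_isoForm :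
    ric m (isoForm m h) = (2 * m - 2 : ℂ) • h + btrace m h • form m := by
  refine LinearMap.ext₂ fun x y => ?_
  have contract_left : ∑ k : Fin (2 * m), h (e k) y * form m x (e k.rev) = h x y :=
    sum_mul_form (LinearMap.flip h y) x
  have contract_right : ∑ k : Fin (2 * m), h x (e k.rev) * form m (e k) y = h x y := by
    simpa only [mul_comm, form_comm y] using sum_form_mul (h x) y
  have trace_form : ∑ k : Fin (2 * m), form m (e k) (e k.rev) = 2 * m := btrace_form
  simp only [ric_apply, curv_isoForm hsymm, Finset.sum_add_distrib, Finset.sum_sub_distrib,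
    ← Finset.mul_sum, ← Finset.sum_mul, contract_left, contract_right, trace_form]
  change _ = (2 * m - 2 : ℂ) * h x y + btrace m h * form m x y
  rw [btrace_apply]
  ring

theorem bianchi_isoForm : bianchi m (isoForm m h) = 0 := by
  refine LinearMap.mem_ker.mp (mem_ker_bianchi.mpr fun u v x y => ?_)
  simp only [bianchiSum, curv_isoForm hsymm, hsymm x, hsymm v u, form_comm x, form_comm v u]
  ring

theorem lie_isoForm (X : so m) :
    ⁅X, isoForm m h⁆ = -isoForm m (h.compLeft X.1 + h.compRight X.1) := by
  have hsymm' (x y : V m) : (-(h.compLeft X.1 + h.compRight X.1)) x y =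
      (-(h.compLeft X.1 + h.compRight X.1)) y x := by
    simp [hsymm x, hsymm (X.1 x), add_comm]
  rw [← map_neg]
  refine curv_ext fun u v x y => ?_
  rw [curv_lie, curv_isoForm hsymm']
  simp only [curv_isoForm hsymm, LinearMap.neg_apply, LinearMap.add_apply, so_skew,
    LinearMap.BilinForm.compLeft_apply, LinearMap.BilinForm.compRight_apply]
  ring

end SymmetricBilinearForm

theorem lie_mem_Viso (X : so m) {q : QuadraticForm ℂ (so m)} (hq : q ∈ Viso m) :
    ⁅X, q⁆ ∈ Viso m := by
  obtain ⟨h, hsymm, rfl⟩ := mem_Viso.mp hq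
  rw [lie_isoForm hsymm, ← map_neg, ← transport_Psi_symTensor]
  exact ⟨_, ⟨_, rfl⟩, rfl⟩

/-- The map `h ↦ (2m - 2) h + (tr h) (·, ·)`, the Ricci contraction of `isoForm m h`. -/
def isoRic (m : ℕ) : LinearMap.BilinForm ℂ (V m) →ₗ[ℂ] LinearMap.BilinForm ℂ (V m) :=
  (2 * m - 2 : ℂ) • LinearMap.id + (btrace m).smulRight (form m)

theorem isoRic_apply (h : LinearMap.BilinForm ℂ (V m)) :
    isoRic m h = (2 * m - 2 : ℂ) • h + btrace m h • form m := rfl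

theorem isoRic_bijective (hm : 2 ≤ m) : Function.Bijective (isoRic m) := by
  have hm₁ : (m : ℂ) - 1 ≠ 0 := sub_ne_zero.mpr (by norm_cast; omega)
  have hm₂ : 2 * (m : ℂ) - 1 ≠ 0 := sub_ne_zero.mpr (by norm_cast; omega)
  have hinj : Function.Injective (isoRic m) := by
    refine (injective_iff_map_eq_zero _).mpr fun h hh => ?_
    rw [isoRic_apply] at hh
    have htrace : btrace m h = 0 := by
      have := congrArg (btrace m) hh
      rw [map_add, map_smul, map_smul, btrace_form, map_zero, smul_eq_mul, smul_eq_mul] at this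
      have : (2 * (m : ℂ) - 1) * (2 * btrace m h) = 0 := by linear_combination this
      simpa [hm₂] using this
    rw [htrace, zero_smul, add_zero, ← mul_sub_one] at hh
    simpa [hm₁] using hh
  exact ⟨hinj, LinearMap.injective_iff_surjective.mp hinj⟩

theorem isoForm_eq_zero_iff (hm : 2 ≤ m) {h : LinearMap.BilinForm ℂ (V m)}
    (hsymm : ∀ x y, h x y = h y x) : isoForm m h = 0 ↔ h = 0 := by
  refine ⟨fun hh => (isoRic_bijective hm).1 ?_, fun hh => by rw [hh, map_zero]⟩
  rw [isoRic_apply, ← ric_isoForm hsymm, hh, map_zero, map_zero]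

theorem Psi_injective (hm : 2 ≤ m) : Function.Injective (Psi m) := by
  refine (injective_iff_map_eq_zero _).mpr fun t ht => ?_
  obtain ⟨h, rfl⟩ := symTensor_surjective t
  have hsymmetrized : h + LinearMap.flip h = 0 := by
    refine (isoForm_eq_zero_iff hm fun x y => by simp [add_comm]).mp ?_
    rw [map_add, isoForm_flip, ← transport_Psi_symTensor, ht, map_zero, add_zero]
  have : (2 : ℂ) • symTensor m h = 0 := by
    rw [two_smul]
    nth_rw 2 [← symTensor_flip]
    rw [← map_add, hsymmetrized, map_zero]
  simpa using this

/-! ### The decomposition -/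

theorem exists_mem_Viso_ric_eq (hm : 2 ≤ m) (q : QuadraticForm ℂ (so m)) :
    ∃ i ∈ Viso m, ric m i = ric m q := by
  obtain ⟨h, hh⟩ := (isoRic_bijective hm).2 (ric m q)
  have hflip : LinearMap.flip h = h := by
    refine (isoRic_bijective hm).1 (LinearMap.ext₂ fun x y => ?_)
    have hxy := LinearMap.congr_fun₂ hh x y
    have hyx := LinearMap.congr_fun₂ hh y x
    rw [ric_comm, ← hxy] at hyx
    simpa only [isoRic_apply, LinearMap.add_apply, LinearMap.smul_apply, LinearMap.flip_apply,
      btrace_flip, form_comm y x] using hyx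
  have hsymm (x y : V m) : h x y = h y x := LinearMap.congr_fun₂ hflip.symm x y
  exact ⟨isoForm m h, mem_Viso.mpr ⟨h, hsymm, rfl⟩, by rw [ric_isoForm hsymm, ← isoRic_apply, hh]⟩

theorem bianchi_eq_zero_of_mem_Viso {q : QuadraticForm ℂ (so m)} (hq : q ∈ Viso m) :
    bianchi m q = 0 := by
  obtain ⟨h, hsymm, rfl⟩ := mem_Viso.mp hq
  exact bianchi_isoForm hsymm

theorem eq_zero_of_mem_Viso_of_ric_eq_zero (hm : 2 ≤ m) {q : QuadraticForm ℂ (so m)}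
    (hq : q ∈ Viso m) (hric : ric m q = 0) : q = 0 := by
  obtain ⟨h, hsymm, rfl⟩ := mem_Viso.mp hq
  rw [ric_isoForm hsymm, ← isoRic_apply] at hric
  rw [(injective_iff_map_eq_zero _).mp (isoRic_bijective hm).1 h hric, map_zero]

theorem eq_zero_of_mem_Vdec_of_bianchi_eq_zero {q : QuadraticForm ℂ (so m)}
    (hq : q ∈ Vdec m) (hbianchi : bianchi m q = 0) : q = 0 := by
  refine curv_ext fun u v x y => ?_
  have h := bianchiSum_of_vanishing (mem_Vdec.mp hq) u v x y
  rw [mem_ker_bianchi.mp hbianchi] at h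
  simpa [curv] using h.symm

theorem exists_decomposition (hm : 2 ≤ m) (q : QuadraticForm ℂ (so m)) :
    ∃ c ∈ weyl m, ∃ d ∈ Vdec m, ∃ i ∈ Viso m, c + d + i = q := by
  obtain ⟨i, hi, hric⟩ := exists_mem_Viso_ric_eq hm q
  refine ⟨q - decPart q - i, ⟨?_, ?_⟩, decPart q, decPart_mem q, i, hi, by abel⟩
  · change bianchi m _ = 0
    rw [map_sub, map_sub, bianchi_decPart, bianchi_eq_zero_of_mem_Viso hi, sub_self, sub_zero]
  · change ric m _ = 0
    rw [map_sub, map_sub, ric_eq_zero_of_mem_Vdec (decPart_mem q), hric, sub_zero, sub_self]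

theorem eq_zero_of_add_add_eq_zero (hm : 2 ≤ m) {c d i : QuadraticForm ℂ (so m)}
    (hc : c ∈ weyl m) (hd : d ∈ Vdec m) (hi : i ∈ Viso m) (h : c + d + i = 0) :
    c = 0 ∧ d = 0 ∧ i = 0 := by
  have hd₀ : d = 0 := by
    refine eq_zero_of_mem_Vdec_of_bianchi_eq_zero hd ?_
    have := congrArg (bianchi m) h
    rwa [map_add, map_add, LinearMap.mem_ker.mp hc.1, bianchi_eq_zero_of_mem_Viso hi, zero_add,
      add_zero, map_zero] at this
  have hi₀ : i = 0 := by
    refine eq_zero_of_mem_Viso_of_ric_eq_zero hm hi ?_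
    have := congrArg (ric m) h
    rwa [map_add, map_add, LinearMap.mem_ker.mp hc.2, ric_eq_zero_of_mem_Vdec hd, zero_add,
      zero_add, map_zero] at this
  subst hd₀ hi₀
  simpa using h

theorem isInternal_weyl_Vdec_Viso (hm : 2 ≤ m) :
    DirectSum.IsInternal ![(weyl m).toSubmodule, Vdec m, Viso m] :=
  isInternal_of_existsUnique_sum (exists_decomposition hm) (eq_zero_of_add_add_eq_zero hm)

/-! ### Isotropic planes -/

theorem form_isSymm : (form m).IsSymm := ⟨form_comm⟩

theorem form_nondegenerate : (form m).Nondegenerate :=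
  ⟨fun x hx => form_nondeg fun u => by rw [form_comm, hx, map_zero],
    fun x hx => form_nondeg fun u => by rw [hx, map_zero]⟩

/-- `a, b` is a basis of a totally isotropic plane. -/
structure IsIsotropicFrame (a b : V m) : Prop where
  linearIndependent : LinearIndependent ℂ ![a, b]
  self_left : form m a a = 0
  self_right : form m b b = 0
  perp : form m a b = 0

theorem IsIsotropicFrame.symm {a b : V m} (h : IsIsotropicFrame a b) : IsIsotropicFrame b a :=
  ⟨LinearIndependent.pair_symm_iff.1 h.linearIndependent, h.self_right, h.self_left,
    (form_comm b a).trans h.perp⟩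

theorem IsIsotropicFrame.left_ne_zero {a b : V m} (h : IsIsotropicFrame a b) : a ≠ 0 :=
  h.linearIndependent.ne_zero 0

theorem exists_isIsotropicFrame (hm : 4 ≤ m) (u v w : V m) :
    ∃ z, ∀ x ∈ ({u, v, w} : Set (V m)), x ≠ 0 → form m x x = 0 → IsIsotropicFrame x z := by
  classical
  have hfr : finrank ℂ (Submodule.span ℂ (({u, v, w} : Finset (V m)) : Set (V m))) ≤ 3 :=
    (finrank_span_finset_le_card _).trans Finset.card_le_three
  obtain ⟨z, hz, hzz, hzS⟩ := exists_isotropic_mem_orthogonal form_isSymm form_nondegenerate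
    (S := Submodule.span ℂ (({u, v, w} : Finset (V m)) : Set (V m)))
    (by rw [finrank_fin_fun]; lia)
  refine ⟨z, fun x hx hx0 hxx => ?_⟩
  have hxS : x ∈ Submodule.span ℂ (({u, v, w} : Finset (V m)) : Set (V m)) :=
    Submodule.subset_span (by simpa using hx)
  refine ⟨(LinearIndependent.pair_iff' hx0).2 fun c hc => hzS ?_, hxx, hzz, hz x hxS⟩
  exact hc ▸ Submodule.smul_mem _ c hxS

/-- All members of `J` vanish at the bivector `u ∧ v`. -/
def VanishAt (J : LieSubmodule ℂ (so m) (QuadraticForm ℂ (so m))) (u v : V m) : Prop :=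
  ∀ q ∈ J, q (bv m u v) = 0

section VanishAt

variable {J : LieSubmodule ℂ (so m) (QuadraticForm ℂ (so m))} {u v w : V m}

theorem VanishAt.swap (h : VanishAt J u v) : VanishAt J v u := fun q hq => by
  rw [bv_swap, QuadraticMap.map_neg, h q hq]

theorem VanishAt.of_mem_span (h : VanishAt J u v) (hw : w ∈ Submodule.span ℂ {u, v}) :
    VanishAt J u w := by
  obtain ⟨a, b, rfl⟩ := Submodule.mem_span_pair.1 hw
  intro q hq
  rw [map_add, map_smul, map_smul, bv_self, smul_zero, zero_add, QuadraticMap.map_smul, h q hq,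
    smul_zero]

theorem VanishAt.transvection (h : VanishAt J u v) {X : so m} (hX : ∀ z, X.1 (X.1 z) = 0) :
    VanishAt J (u + X.1 u) (v + X.1 v) := by
  intro q hq
  have h1 : ⁅X, bv m u v⁆ = bv m (X.1 u) v + bv m u (X.1 v) := lie_bv X u v
  have h2 : ⁅X, ⁅X, bv m u v⁆⁆ = (2 : ℂ) • bv m (X.1 u) (X.1 v) := by
    rw [h1, lie_add, lie_bv, lie_bv, hX, hX, map_zero, map_zero, LinearMap.zero_apply, zero_add,
      add_zero, two_smul]
  have h3 : ⁅X, ⁅X, ⁅X, bv m u v⁆⁆⁆ = 0 := by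
    rw [h2, lie_smul, lie_bv, hX, hX, map_zero, map_zero, LinearMap.zero_apply, add_zero,
      smul_zero]
  have hexp : bv m (u + X.1 u) (v + X.1 v) =
      bv m u v + ⁅X, bv m u v⁆ + (2 : ℂ)⁻¹ • ⁅X, ⁅X, bv m u v⁆⁆ := by
    rw [h2, h1, inv_smul_smul₀ two_ne_zero]
    simp only [map_add, LinearMap.add_apply]
    abel
  have hlie : ∀ {r}, r ∈ J → ⁅X, r⁆ ∈ J := J.lie_mem
  rw [hexp, quad_exp_apply h3, h q hq, h _ (hlie hq), h _ (hlie (hlie hq)),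
    h _ (hlie (hlie (hlie hq))), h _ (hlie (hlie (hlie (hlie hq))))]
  ring

theorem bv_apply_bv_apply_eq_zero {x y : V m} (hx : form m x x = 0) (hy : form m y y = 0)
    (hxy : form m x y = 0) (z : V m) : (bv m x y).1 ((bv m x y).1 z) = 0 := by
  simp [bv_apply, hx, hy, hxy, form_comm y x]

/-- The transvection `1 + z ∧ (w - v)` fixes `u` and maps `v` to `w`. -/
theorem VanishAt.move_of_perp (h : VanishAt J u v) (huv : IsIsotropicFrame u v)
    (huw : IsIsotropicFrame u w) (hvw : form m v w = 0) : VanishAt J u w := by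
  by_cases hw : w ∈ Submodule.span ℂ {u, v}
  · exact h.of_mem_span hw
  have hli : LinearIndependent ℂ ![w, u, v] :=
    linearIndependent_finCons.2 ⟨huv.linearIndependent, by simpa [Set.pair_comm v u] using hw⟩
  obtain ⟨x, hx⟩ := exists_bilin_apply_eq form_nondegenerate hli ![1, 0, 1]
  have hxw : form m x w = 1 := hx 0
  have hxu : form m x u = 0 := hx 1
  have hxv : form m x v = 1 := hx 2
  have hvu : form m v u = 0 := huv.symm.perp
  have hwu : form m w u = 0 := huw.symm.perp
  set z := x - (form m x x / 2) • v with hz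
  have hzz : form m z z = 0 := by
    simp only [hz, map_sub, LinearMap.sub_apply, map_smul, LinearMap.smul_apply, form_comm v x,
      hxv, huv.self_right, smul_eq_mul]
    ring
  have hzu : form m z u = 0 := by simp [hz, hxu, hvu]
  have hzv : form m z v = 1 := by simp [hz, hxv, huv.self_right]
  have hzw : form m z w = 1 := by simp [hz, hxw, hvw]
  have hXX := bv_apply_bv_apply_eq_zero hzz (y := w - v)
    (by simp [huv.self_right, huw.self_right, hvw, form_comm w v]) (by simp [hzv, hzw])
  have hXu : (bv m z (w - v)).1 u = 0 := by simp [bv_apply, hzu, hwu, hvu]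
  have hXv : (bv m z (w - v)).1 v = w - v := by
    simp [bv_apply, hzv, form_comm w v, hvw, huv.self_right]
  have hmove := h.transvection hXX
  rwa [hXu, hXv, add_zero, add_sub_cancel] at hmove

theorem VanishAt.move (hm : 4 ≤ m) (h : VanishAt J u v) (huv : IsIsotropicFrame u v)
    (huw : IsIsotropicFrame u w) : VanishAt J u w := by
  obtain ⟨z, hz⟩ := exists_isIsotropicFrame hm u v w
  have huz := hz u (by simp) huv.left_ne_zero huv.self_left
  have hvz := hz v (by simp) huv.symm.left_ne_zero huv.self_right
  have hwz := hz w (by simp) huw.symm.left_ne_zero huw.self_right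
  exact (h.move_of_perp huv huz hvz.perp).move_of_perp huz huw hwz.symm.perp

theorem VanishAt.of_frame (hm : 4 ≤ m) {a b : V m} (h : VanishAt J a b)
    (hab : IsIsotropicFrame a b) (huv : IsIsotropicFrame u v) : VanishAt J u v := by
  obtain ⟨z, hz⟩ := exists_isIsotropicFrame hm a u v
  have haz := hz a (by simp) hab.left_ne_zero hab.self_left
  have hvz := hz v (by simp) huv.symm.left_ne_zero huv.self_right
  have hz_v : VanishAt J z v := (h.move hm hab haz).swap.move hm haz.symm hvz.symm
  exact (hz_v.swap.move hm hvz huv.symm).swap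

end VanishAt

/-! ### Curvature tensors of Weyl type are determined by isotropic planes -/

theorem btrace_of_vanishing_perp {D : LinearMap.BilinForm ℂ (V m)} {u p : V m}
    (hp : form m p u = 1) (h : ∀ x y, form m x u = 0 → form m y u = 0 → D x y = 0) :
    btrace m D = D p u + D u p - form m u u * D p p := by
  have hD : ∀ x y, D x y = form m u x * D p y + D x p * form m u y
      - form m u x * form m u y * D p p := by
    intro x y
    have hxy := h (x - form m x u • p) (y - form m y u • p) (by simp [hp]) (by simp [hp])
    simp only [map_sub, LinearMap.sub_apply, map_smul, LinearMap.smul_apply, smul_eq_mul] at hxy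
    rw [form_comm u x, form_comm u y]
    linear_combination hxy
  rw [btrace_apply, Finset.sum_congr rfl fun k _ => hD _ _, Finset.sum_sub_distrib,
    Finset.sum_add_distrib, ← Finset.sum_mul, sum_form_mul (D p), sum_form_mul (form m u)]
  congr 2
  exact sum_mul_form (D.flip p) u

/-- The Jacobi form `(x, y) ↦ R(u, x, u, y)` of the curvature tensor `R = curv q`. -/
def jacobiForm (q : QuadraticForm ℂ (so m)) (u : V m) : LinearMap.BilinForm ℂ (V m) :=
  (QuadraticMap.associated q).compl₁₂ (bv m u) (bv m u)

theorem jacobiForm_apply (q : QuadraticForm ℂ (so m)) (u x y : V m) :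
    jacobiForm q u x y = curv q u x u y := rfl

theorem exists_form_eq_one {u : V m} (hu : u ≠ 0) :
    ∃ p, form m p u = 1 ∧ (form m u u = 0 ∨ ∃ s : ℂ, p = s • u) := by
  by_cases huu : form m u u = 0
  · obtain ⟨p, hp⟩ := exists_bilin_apply_eq form_nondegenerate
      (LinearIndependent.of_subsingleton (v := ![u]) 0 hu) 1
    exact ⟨p, hp 0, Or.inl huu⟩
  · exact ⟨(form m u u)⁻¹ • u, by simp [huu], Or.inr ⟨_, rfl⟩⟩

/-- The Jacobi form is `c • form` on the hyperplane orthogonal to `u`; computing its trace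
`ric q u u = 0` forces `c = 0`. -/
theorem quad_bv_eq_zero_of_perp (hm : 2 ≤ m) {q : QuadraticForm ℂ (so m)} {u x : V m} (hu : u ≠ 0)
    (hric : ric m q u u = 0)
    (h : ∀ y, form m u y = 0 → form m y y = 0 → q (bv m u y) = 0) (hux : form m u x = 0) :
    q (bv m u x) = 0 := by
  have hperp : ∀ y, y ∈ (form m).orthogonal (ℂ ∙ u) ↔ form m u y = 0 := fun y => by
    rw [LinearMap.BilinForm.orthogonal_span_singleton_eq_toLin_ker]
    rfl
  obtain ⟨c, hc⟩ := exists_eq_mul_on_orthogonal (D := jacobiForm q u) form_isSymm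
    form_nondegenerate ⟨fun x y => curv_symm q u x u y⟩ (S := ℂ ∙ u)
    (by rw [finrank_span_singleton hu, finrank_fin_fun]; lia)
    (fun y hy hyy => (curv_self q u y).trans (h y ((hperp y).1 hy) hyy))
  simp only [hperp] at hc
  obtain ⟨p, hpu, hp⟩ := exists_form_eq_one hu
  have htr := btrace_of_vanishing_perp (D := jacobiForm q u - c • form m) hpu fun x y hx hy => by
    simp [hc x ((form_comm u x).trans hx) y ((form_comm u y).trans hy)]
  suffices c = 0 by rw [← curv_self, ← jacobiForm_apply, hc x hux x hux, this, zero_mul]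
  have hJtr : btrace m (jacobiForm q u) = 0 := by
    rw [← hric, ric_apply, btrace_apply]
    rfl
  have hJu : ∀ y, jacobiForm q u u y = 0 ∧ jacobiForm q u y u = 0 := by simp [jacobiForm]
  rw [map_sub, map_smul, hJtr, btrace_form] at htr
  simp only [LinearMap.sub_apply, LinearMap.smul_apply, smul_eq_mul, hJu, hpu,
    form_comm u p] at htr
  rcases hp with huu | ⟨s, rfl⟩
  · have hc0 : ((m : ℂ) - 1) * c = 0 := by
      linear_combination -htr / 2 + (jacobiForm q u p p - c * form m p p) / 2 * huu
    refine (mul_eq_zero.1 hc0).resolve_left (sub_ne_zero.2 ?_)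
    exact_mod_cast (by lia : m ≠ 1)
  · rw [LinearMap.map_smul₂, smul_eq_mul] at hpu
    simp only [hJu, map_smul, LinearMap.smul_apply, smul_eq_mul] at htr
    have hc0 : (2 * (m : ℂ) - 1) * c = 0 := by
      linear_combination -htr - c * (s * form m u u + 1) * hpu
    refine (mul_eq_zero.1 hc0).resolve_left (sub_ne_zero.2 ?_)
    exact_mod_cast (by lia : 2 * m ≠ 1)

theorem weyl_eq_zero_of_isotropic (hm : 2 ≤ m) {q : QuadraticForm ℂ (so m)} (hq : q ∈ weyl m)
    (h : ∀ u v, IsIsotropicFrame u v → q (bv m u v) = 0) : q = 0 := by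
  obtain ⟨hbianchi, hric⟩ := hq
  have hric : ∀ u, ric m q u u = 0 := fun u => LinearMap.congr_fun₂ hric u u
  have hperp : ∀ u v, form m u u = 0 → form m u v = 0 → q (bv m u v) = 0 := by
    intro u v huu huv
    by_cases hu : u = 0
    · simp [hu]
    refine quad_bv_eq_zero_of_perp hm hu (hric u) (fun y huy hyy => ?_) huv
    by_cases hli : LinearIndependent ℂ ![u, y]
    · exact h u y ⟨hli, huu, hyy, huy⟩
    · obtain ⟨c, rfl⟩ : ∃ c : ℂ, c • u = y := by
        simpa [LinearIndependent.pair_iff' hu] using hli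
      simp
  have hanisotropic : ∀ u v, form m u u ≠ 0 → q (bv m u v) = 0 := by
    intro u v huu
    have hproj := quad_bv_eq_zero_of_perp hm (u := u) (fun hu => huu (by simp [hu])) (hric u)
      (fun y huy hyy => by
        rw [bv_swap, QuadraticMap.map_neg, hperp y u hyy ((form_comm y u).trans huy)])
      (x := v - (form m u v / form m u u) • u) (by simp [huu])
    simpa using hproj
  have hvanish : ∀ u v, q (bv m u v) = 0 := by
    intro u v
    by_cases huu : form m u u = 0
    · by_cases huv : form m u v = 0
      · exact hperp u v huu huv
      by_cases hvv : form m v v = 0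
      · have hsum := hanisotropic (u + v) v (by simp [huu, hvv, form_comm v u, huv, ← two_mul])
        simpa using hsum
      · rw [bv_swap, QuadraticMap.map_neg, hanisotropic v u hvv]
    · exact hanisotropic u v huu
  exact eq_zero_of_mem_Vdec_of_bianchi_eq_zero (mem_Vdec.2 hvanish) hbianchi

/-! ### Irreducibility of the forms of Weyl type -/

theorem traceForm_bv (u v : V m) (Y : so m) :
    LieModule.traceForm ℂ (so m) (V m) (bv m u v) Y = 2 * form m u (Y.1 v) := by
  have hcomp : LieModule.toEnd ℂ (so m) (V m) (bv m u v) ∘ₗ LieModule.toEnd ℂ (so m) (V m) Y =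
      (form m u ∘ₗ Y.1).smulRight v - (form m v ∘ₗ Y.1).smulRight u :=
    LinearMap.ext fun z => bv_apply u v (Y.1 z)
  have hskew : form m v (Y.1 u) = -form m u (Y.1 v) := by rw [form_comm, so_skew]
  rw [LieModule.traceForm_apply_apply, hcomp, map_sub, LinearMap.trace_smulRight,
    LinearMap.trace_smulRight, LinearMap.comp_apply, LinearMap.comp_apply, hskew]
  ring

theorem traceForm_nondegenerate : (LieModule.traceForm ℂ (so m) (V m)).Nondegenerate := by
  refine (LieModule.traceForm_isSymm ℂ (so m) (V m)).isRefl.nondegenerate_iff_separatingLeft.2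
    fun Y hY => Subtype.ext (LinearMap.ext fun v => form_nondeg fun u => ?_)
  have h := hY (bv m u v)
  rw [LieModule.traceForm_comm, traceForm_bv] at h
  simpa using h

/-- The square of the linear form `tr (X ·)` on `so_{2m}`. -/
def sqForm (X : so m) : QuadraticForm ℂ (so m) :=
  QuadraticMap.linMulLin (LieModule.traceForm ℂ (so m) (V m) X)
    (LieModule.traceForm ℂ (so m) (V m) X)

theorem sqForm_apply (X Y : so m) : sqForm X Y =
    LieModule.traceForm ℂ (so m) (V m) X Y * LieModule.traceForm ℂ (so m) (V m) X Y := rfl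

theorem lie_lie_bv {a b : V m} (haa : form m a a = 0) (hbb : form m b b = 0)
    (hab : form m a b = 0) (Y : so m) : ⁅bv m a b, ⁅bv m a b, Y⁆⁆ =
      -LieModule.traceForm ℂ (so m) (V m) (bv m a b) Y • bv m a b := by
  have h : LieModule.toEnd ℂ (so m) (so m) (bv m a b) ∘ₗ
      LieModule.toEnd ℂ (so m) (so m) (bv m a b) =
      (-LieModule.traceForm ℂ (so m) (V m) (bv m a b)).smulRight (bv m a b) := by
    refine so_linearMap_ext fun u v => ?_
    simp only [LinearMap.comp_apply, LieModule.toEnd_apply_apply, lie_bv, map_add,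
      bv_apply_bv_apply_eq_zero haa hbb hab, map_zero, LinearMap.zero_apply,
      LinearMap.smulRight_apply, LinearMap.neg_apply, traceForm_bv]
    simp only [bv_apply, map_sub, map_smul, LinearMap.sub_apply, LinearMap.smul_apply, bv_self,
      smul_zero, smul_eq_mul, bv_swap b a, form_comm u b, form_comm v b]
    module
  exact LinearMap.congr_fun h Y

theorem lie_bv_pow_four {a b : V m} (haa : form m a a = 0) (hbb : form m b b = 0)
    (hab : form m a b = 0) (q : QuadraticForm ℂ (so m)) :
    ⁅bv m a b, ⁅bv m a b, ⁅bv m a b, ⁅bv m a b, q⁆⁆⁆⁆ =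
      (6 * q (bv m a b)) • sqForm (bv m a b) := by
  ext Y
  have hnil : ⁅bv m a b, ⁅bv m a b, ⁅bv m a b, Y⁆⁆⁆ = 0 := by
    rw [lie_lie_bv haa hbb hab Y, lie_smul, lie_self, smul_zero]
  rw [lie_lie_lie_lie_quad_apply hnil, lie_lie_bv haa hbb hab, QuadraticMap.map_smul,
    _root_.smul_apply, sqForm_apply, smul_eq_mul, smul_eq_mul]
  ring

section IsotropicFrame

variable {a b : V m}

theorem IsIsotropicFrame.bv_ne_zero (hab : IsIsotropicFrame a b) : bv m a b ≠ 0 := by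
  intro h
  obtain ⟨p, hp⟩ := exists_bilin_apply_eq form_nondegenerate hab.linearIndependent ![0, 1]
  have hpa : form m p a = 0 := hp 0
  have hpb : form m p b = 1 := hp 1
  refine hab.left_ne_zero ?_
  simpa [bv_apply, form_comm _ p, hpa, hpb] using congrArg (fun X : so m => X.1 p) h

theorem exists_mem_weyl_ne_zero (hm : 2 ≤ m) (hab : IsIsotropicFrame a b) :
    ∃ q ∈ weyl m, q (bv m a b) ≠ 0 := by
  obtain ⟨Z, hZ⟩ : ∃ Z, LieModule.traceForm ℂ (so m) (V m) Z (bv m a b) ≠ 0 := by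
    by_contra! h0
    exact hab.bv_ne_zero (traceForm_nondegenerate.2 _ h0)
  obtain ⟨c, hc, d, hd, i, hi, hsum⟩ := exists_decomposition hm (sqForm Z)
  have hi0 : i (bv m a b) = 0 := by
    obtain ⟨h, hsymm, rfl⟩ := mem_Viso.1 hi
    rw [← curv_self, curv_isoForm hsymm, hab.self_left, hab.self_right, hab.perp, hab.symm.perp]
    ring
  have hc0 : c (bv m a b) = sqForm Z (bv m a b) := by
    rw [← hsum, add_apply, add_apply, mem_Vdec.1 hd, hi0, add_zero, add_zero]
  exact ⟨c, hc, hc0 ▸ mul_ne_zero hZ hZ⟩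

theorem exists_mem_ne_zero_of_le_weyl (hm : 4 ≤ m) (hab : IsIsotropicFrame a b)
    {N : LieSubmodule ℂ (so m) (QuadraticForm ℂ (so m))} (hN : N ≤ weyl m) (hN0 : N ≠ ⊥) :
    ∃ q ∈ N, q (bv m a b) ≠ 0 := by
  by_contra! h
  refine hN0 ((LieSubmodule.eq_bot_iff N).2 fun q hq => ?_)
  exact weyl_eq_zero_of_isotropic (by lia) (hN hq) fun u v huv =>
    VanishAt.of_frame hm h hab huv q hq

theorem sqForm_bv_mem {N : LieSubmodule ℂ (so m) (QuadraticForm ℂ (so m))}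
    (hab : IsIsotropicFrame a b) {q : QuadraticForm ℂ (so m)} (hq : q ∈ N)
    (hq0 : q (bv m a b) ≠ 0) : sqForm (bv m a b) ∈ N := by
  have hmem : (6 * q (bv m a b)) • sqForm (bv m a b) ∈ N := by
    rw [← lie_bv_pow_four hab.self_left hab.self_right hab.perp]
    exact N.lie_mem (N.lie_mem (N.lie_mem (N.lie_mem hq)))
  exact (Submodule.smul_mem_iff N.toSubmodule (mul_ne_zero (by norm_num) hq0)).1 hmem

end IsotropicFrame

theorem isIsotropicFrame_e {i j : Fin (2 * m)} (hne : i ≠ j) (hrev : i ≠ j.rev) :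
    IsIsotropicFrame (e i) (e j) := by
  have hself : ∀ k : Fin (2 * m), form m (e k) (e k) = 0 := fun k => by
    rw [form_e_e, if_neg fun h => ?_]
    have := congrArg Fin.val h
    rw [Fin.val_rev] at this
    lia
  refine ⟨?_, hself i, hself j, by rw [form_e_e, if_neg hrev]⟩
  have hpair : ![e i, e j] = Pi.basisFun ℂ (Fin (2 * m)) ∘ ![i, j] :=
    funext fun k => by fin_cases k <;> simp
  rw [hpair]
  exact (Pi.basisFun ℂ (Fin (2 * m))).linearIndependent.comp _
    (by simpa [Function.Injective, Fin.forall_fin_two] using ⟨hne, hne.symm⟩)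

theorem weyl_isAtom (hm : 4 ≤ m) : IsAtom (weyl m) := by
  obtain ⟨a, b, hab⟩ : ∃ a b : V m, IsIsotropicFrame a b :=
    ⟨e ⟨0, by lia⟩, e ⟨1, by lia⟩, isIsotropicFrame_e (by simp) (by simp [Fin.ext_iff]; lia)⟩
  obtain ⟨q₀, hq₀, hq₀_ne⟩ := exists_mem_weyl_ne_zero (by lia) hab
  have hweyl : weyl m ≠ ⊥ := fun h => by
    rw [h, LieSubmodule.mem_bot] at hq₀
    exact hq₀_ne (by simp [hq₀])
  refine isAtom_of_lieInvariant (quadPairing_lieInvariant traceForm_nondegenerate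
    (LieModule.traceForm_lieInvariant ℂ (so m) (V m))) hweyl (s := sqForm (bv m a b))
    fun N hN hN0 => ?_
  obtain ⟨q, hq, hq0⟩ := exists_mem_ne_zero_of_le_weyl hm hab hN hN0
  refine ⟨sqForm_bv_mem hab hq hq0, q, hq, ?_⟩
  rwa [sqForm, quadPairing_linMulLin _ ⟨LieModule.traceForm_comm ℂ (so m) (V m)⟩]

/-! ### Uniqueness of highest weight representations -/

/-- The diagonal matrix with entries `m - 1/2 - i`; under its adjoint action the matrix `bv (e i)
(e j)` has eigenvalue `2 * m - 1 - (i + j)`. -/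
def gradingElt (m : ℕ) : so m :=
  ⟨LinearMap.pi fun i => ((m : ℂ) - 1 / 2 - (i : ℕ)) • LinearMap.proj i, by
    rw [mem_so_iff]
    intro v w
    simp only [form_apply, LinearMap.pi_apply, LinearMap.smul_apply, LinearMap.proj_apply,
      smul_eq_mul, ← Finset.sum_neg_distrib]
    refine Finset.sum_congr rfl fun i _ => ?_
    rw [Fin.val_rev, Nat.cast_sub (by lia)]
    push_cast
    ring⟩

theorem gradingElt_apply_e (i : Fin (2 * m)) :
    (gradingElt m).1 (e i) = ((m : ℂ) - 1 / 2 - (i : ℕ)) • e i := by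
  ext j
  rcases eq_or_ne j i with rfl | h
  · simp [gradingElt]
  · simp [gradingElt, h]

theorem gradingElt_mem_cartan : gradingElt m ∈ cartan m := by
  intro i j hij
  rw [entry_eq, gradingElt_apply_e]
  simp [hij]

theorem gradingElt_lie_bv (i j : Fin (2 * m)) : ⁅gradingElt m, bv m (e i) (e j)⁆ =
    (2 * m - 1 - ((i : ℕ) + (j : ℕ)) : ℂ) • bv m (e i) (e j) := by
  rw [lie_bv, gradingElt_apply_e, gradingElt_apply_e, map_smul, map_smul, LinearMap.smul_apply,
    ← add_smul]
  congr 1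
  ring

theorem entry_bv_eq_zero {i j k l : Fin (2 * m)}
    (h : (k : ℕ) + (2 * m - 1) ≠ l + (i + j)) : entry (bv m (e i) (e j)) k l = 0 := by
  have hi : i = l.rev → k ≠ j := by rintro rfl rfl; rw [Fin.val_rev] at h; lia
  have hj : j = l.rev → k ≠ i := by rintro rfl rfl; rw [Fin.val_rev] at h; lia
  rw [entry_eq, bv_apply, form_e_e, form_e_e]
  split_ifs with hil hjl hjl <;> simp [*]

theorem bv_mem_cartan {i j : Fin (2 * m)} (h : (i : ℕ) + j = 2 * m - 1) :
    bv m (e i) (e j) ∈ cartan m :=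
  fun _ _ hkl => entry_bv_eq_zero (by have := Fin.val_ne_of_ne hkl; lia)

theorem bv_mem_nilp {i j : Fin (2 * m)} (h : (i : ℕ) + j < 2 * m - 1) :
    bv m (e i) (e j) ∈ nilp m :=
  fun _ _ hkl => entry_bv_eq_zero (by have := Fin.le_def.1 hkl; lia)

/-- The strictly lower triangular matrices among the `bv (e i) (e j)`. -/
def lowerRootVectors (m : ℕ) : Set (so m) :=
  {X | ∃ i j : Fin (2 * m), 2 * m - 1 < (i : ℕ) + j ∧ bv m (e i) (e j) = X}

theorem gradingElt_lie_lowerRootVector {X : so m} (hX : X ∈ lowerRootVectors m) :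
    ∃ n : ℕ, ⁅gradingElt m, X⁆ = -((n : ℂ) + 1) • X := by
  obtain ⟨i, j, hij, rfl⟩ := hX
  refine ⟨i + j - 2 * m, ?_⟩
  rw [gradingElt_lie_bv, Nat.cast_sub (by lia)]
  congr 1
  push_cast
  ring

section HighestWeight

variable {M N : Type*} [AddCommGroup M] [Module ℂ M] [LieRingModule (so m) M]
  [LieModule ℂ (so m) M] [AddCommGroup N] [Module ℂ N] [LieRingModule (so m) N]
  [LieModule ℂ (so m) N] {μ : Dual ℂ (cartan m)}

theorem lie_mem_stableSpan_lowerRootVectors {v : M} (hH : ∀ H : cartan m, ⁅(H : so m), v⁆ = μ H • v)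
    (hn : ∀ X ∈ nilp m, ⁅X, v⁆ = 0) (X : so m) : ⁅X, v⁆ ∈ stableSpan ℂ (lowerRootVectors m) v := by
  have hX : X ∈ Submodule.span ℂ (Set.range fun p : Fin (2 * m) × Fin (2 * m) =>
      bv m (e p.1) (e p.2)) := span_bv_e ▸ Submodule.mem_top
  induction hX using Submodule.span_induction with
  | zero => rw [zero_lie]; exact zero_mem _
  | add X Y _ _ hX hY => rw [add_lie]; exact add_mem hX hY
  | smul c X _ hX => rw [smul_lie]; exact Submodule.smul_mem _ c hX
  | mem X hX =>
    obtain ⟨⟨i, j⟩, rfl⟩ := hX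
    rcases lt_trichotomy ((i : ℕ) + j) (2 * m - 1) with h | h | h
    · rw [hn _ (bv_mem_nilp h)]
      exact zero_mem _
    · rw [hH ⟨_, bv_mem_cartan h⟩]
      exact Submodule.smul_mem _ _ self_mem_stableSpan
    · have hij : bv m (e i) (e j) ∈ lowerRootVectors m := ⟨i, j, h, rfl⟩
      exact lie_mem_stableSpan hij self_mem_stableSpan

theorem mem_span_of_mem_lieSpan {v : M} (hH : ∀ H : cartan m, ⁅(H : so m), v⁆ = μ H • v)
    (hn : ∀ X ∈ nilp m, ⁅X, v⁆ = 0) {x : M} (hx : x ∈ LieSubmodule.lieSpan ℂ (so m) {v})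
    (hxH : ∀ H : cartan m, ⁅(H : so m), x⁆ = μ H • x) : x ∈ Submodule.span ℂ {v} :=
  mem_span_of_mem_stableSpan (fun _ => gradingElt_lie_lowerRootVector)
    (hH ⟨_, gradingElt_mem_cartan⟩)
    (lieSpan_le_stableSpan (lie_mem_stableSpan_lowerRootVectors hH hn) hx)
    (hxH ⟨_, gradingElt_mem_cartan⟩)

theorem nonempty_equiv_of_highestWeight (hM : IsIrrepOfHighestWeight m M μ)
    (hN : IsIrrepOfHighestWeight m N μ) : Nonempty (M ≃ₗ⁅ℂ, so m⁆ N) := by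
  have := hM.irreducible
  have := hN.irreducible
  obtain ⟨x, hx, hxH, hxn⟩ := hM.highestWeight
  obtain ⟨y, hy, hyH, hyn⟩ := hN.highestWeight
  have hspan {p : M × N} (hp : p ∈ LieSubmodule.lieSpan ℂ (so m) {(x, y)})
      (hpH : ∀ H : cartan m, ⁅(H : so m), p⁆ = μ H • p) : ∃ c : ℂ, c • x = p.1 ∧ c • y = p.2 := by
    obtain ⟨c, rfl⟩ := Submodule.mem_span_singleton.1 (mem_span_of_mem_lieSpan
      (fun H => Prod.ext (hxH H) (hyH H)) (fun X hX => Prod.ext (hxn X hX) (hyn X hX)) hp hpH)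
    exact ⟨c, rfl, rfl⟩
  refine nonempty_equiv_of_lieSpan hx hy (fun hmem => ?_) (fun hmem => ?_)
  · obtain ⟨c, hcx, hcy⟩ := hspan hmem fun H => by simp [prod_lie, hxH]
    obtain rfl : c = 0 := (smul_eq_zero.1 hcy).resolve_right hy
    exact hx (by simpa using hcx.symm)
  · obtain ⟨c, hcx, hcy⟩ := hspan hmem fun H => by simp [prod_lie, hyH]
    obtain rfl : c = 0 := (smul_eq_zero.1 hcx).resolve_right hx
    exact hy (by simpa using hcy.symm)

end HighestWeight

/-! ### The dual of the space of forms of Weyl type -/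

theorem hasHighestWeightVector_dual_quadraticForm {M : Type*} [AddCommGroup M] [Module ℂ M]
    [LieRingModule (so m) M] [LieModule ℂ (so m) M]
    {C : LieSubmodule ℂ (so m) (QuadraticForm ℂ M)} {μ : Dual ℂ (cartan m)} {y : M}
    (hy : evalDual C y ≠ 0) (hH : ∀ H : cartan m, ⁅(H : so m), y⁆ = μ H • y)
    (hn : ∀ X ∈ nilp m, ⁅X, y⁆ = 0) : HasHighestWeightVector m (Dual ℂ C) ((2 : ℂ) • μ) := by
  refine ⟨evalDual C y, hy, fun H => lie_evalDual (hH H), fun X hX => ?_⟩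
  have h : ⁅X, y⁆ = (0 : ℂ) • y := by rw [hn X hX, zero_smul]
  rw [lie_evalDual h, mul_zero, zero_smul]

theorem cartan_apply_e (H : cartan m) (i : Fin (2 * m)) :
    (H : so m).1 (e i) = eps i H • e i := by
  ext j
  rw [← entry_eq]
  rcases eq_or_ne j i with rfl | hji
  · simp [eps]
  · simp [H.2 j i hji, hji]

theorem cartan_lie_bv (H : cartan m) (i j : Fin (2 * m)) :
    ⁅(H : so m), bv m (e i) (e j)⁆ = (eps i + eps j) H • bv m (e i) (e j) := by
  rw [lie_bv, cartan_apply_e, cartan_apply_e, map_smul, map_smul, LinearMap.smul_apply,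
    ← add_smul, LinearMap.add_apply]

theorem nilp_lie_bv {X : so m} (hX : X ∈ nilp m) {i j : Fin (2 * m)} (hi : (i : ℕ) = 0)
    (hj : (j : ℕ) = 1) : ⁅X, bv m (e i) (e j)⁆ = 0 := by
  have hXi : X.1 (e i) = 0 := by
    ext k
    rw [← entry_eq, hX k i (Fin.le_def.2 (by lia)), Pi.zero_apply]
  have hXj : X.1 (e j) = entry X i j • e i := by
    ext k
    rw [← entry_eq]
    rcases eq_or_ne k i with rfl | hki
    · simp
    · have hjk : j ≤ k := Fin.le_def.2 (by have := Fin.val_ne_of_ne hki; lia)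
      simp [hX k j hjk, hki]
  rw [lie_bv, hXi, hXj, map_zero, LinearMap.zero_apply, map_smul, bv_self, smul_zero, add_zero]

theorem dual_weyl_isIrrep (hm : 4 ≤ m) :
    IsIrrepOfHighestWeight m (Dual ℂ (weyl m)) ((2 : ℂ) • highestRoot m hm) where
  finiteDimensional := inferInstance
  irreducible := dual_isIrreducible (isIrreducible_of_isAtom (weyl_isAtom hm))
  highestWeight := by
    obtain ⟨q, hq, hq0⟩ := exists_mem_weyl_ne_zero (m := m) (by lia) (isIsotropicFrame_e
      (i := ⟨0, by lia⟩) (j := ⟨1, by lia⟩) (by simp) (by simp [Fin.ext_iff]; lia))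
    exact hasHighestWeightVector_dual_quadraticForm
      (fun h => hq0 (LinearMap.congr_fun h (⟨q, hq⟩ : weyl m)))
      (fun H => cartan_lie_bv H _ _) (fun X hX => nilp_lie_bv hX rfl rfl)

/-- `V_dec` as a subrepresentation of the quadratic forms. -/
def decLie (m : ℕ) : LieSubmodule ℂ (so m) (QuadraticForm ℂ (so m)) :=
  { Vdec m with lie_mem {X _} h := lie_mem_Vdec X h }

/-- `V_iso` as a subrepresentation of the quadratic forms. -/
def isoLie (m : ℕ) : LieSubmodule ℂ (so m) (QuadraticForm ℂ (so m)) :=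
  { Viso m with lie_mem {X _} h := lie_mem_Viso X h }

end SOQuad

end

theorem mainTheorem8 (m : ℕ) (hm : 4 ≤ m) :
    Function.Injective (SOQuad.Phi m) ∧ Function.Injective (SOQuad.Psi m) ∧
    ∃ C D I : LieSubmodule ℂ (SOQuad.so m) (QuadraticForm ℂ (SOQuad.so m)),
      D.toSubmodule = SOQuad.Vdec m ∧ I.toSubmodule = SOQuad.Viso m ∧
      DirectSum.IsInternal ![C.toSubmodule, D.toSubmodule, I.toSubmodule] ∧
      SOQuad.IsIrrepOfHighestWeight m (Module.Dual ℂ C) ((2 : ℂ) • SOQuad.highestRoot m hm) ∧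
      ∀ (W : Type*) [AddCommGroup W] [Module ℂ W] [LieRingModule (SOQuad.so m) W]
        [LieModule ℂ (SOQuad.so m) W],
        SOQuad.IsIrrepOfHighestWeight m W ((2 : ℂ) • SOQuad.highestRoot m hm) →
          Nonempty (Module.Dual ℂ W ≃ₗ⁅ℂ, SOQuad.so m⁆ C) := by
  refine ⟨SOQuad.Phi_injective, SOQuad.Psi_injective (by lia), SOQuad.weyl m, SOQuad.decLie m,
    SOQuad.isoLie m, rfl, rfl, SOQuad.isInternal_weyl_Vdec_Viso (by lia),
    SOQuad.dual_weyl_isIrrep hm, fun W _ _ _ _ hW => ?_⟩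
  obtain ⟨f⟩ := SOQuad.nonempty_equiv_of_highestWeight hW (SOQuad.dual_weyl_isIrrep hm)
  exact ⟨(SOQuad.lieEquivDualFlip f).symm⟩
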